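/- Let $\lambda$ be the normalized Lebesgue measure on the unit circle $\mathbb T$, and let $\alpha\in L^1(\mathbb T)$ be a real weight with $\alpha\ge c>0$ a.e. for some constant $c$ and $\log\alpha\in L^1(\mathbb T)$. For $0<p<\infty$ let $L^p_\alpha(\mathbb T)$ be the space of (classes of) measurable functions $\phi:\mathbb T\to\mathbb C$ with $$\|\phi\|_{\alpha,p}=\Bigl(\int_{\mathbb T}|\phi|^p\,\alpha\,d\lambda\Bigr)^{1/p}<\infty .$$ The Smirnov class $N^+$ consists of the holomorphic functions $f$ on the unit disk $\mathbb D$ with $\sup_{0\le r<1}\int_{\mathbb T}\log^+|f(re^{i\theta})|\,d\lambda<\infty$ and $\lim_{r\to1^-}\int_{\mathbb T}\log^+|f(re^{i\theta})|\,d\lambda=\int_{\mathbb T}\log^+|f(e^{i\theta})|\,d\lambda$, where $f(e^{i\theta})=\lim_{r\to1^-}f(re^{i\theta})$ for a.e. $\theta$. Let $H^p_\alpha=N^+\cap L^p_\alpha(\mathbb T)$, i.e. the set of elements of $L^p_\alpha(\mathbb T)$ that are boundary functions of functions in $N^+$, with the norm $\|\cdot\|_{\alpha,p}$. Let $a$ be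 an outer function with boundary modulus $\alpha$, that is, $$a(z)=\gamma\exp\Bigl(\int_{\mathbb T}\frac{e^{i\theta}+z}{e^{i\theta}-z}\,\log\alpha(e^{i\theta})\,d\lambda\Bigr)\quad(z\in\mathbb D),\qquad |\gamma|=1 .$$ **Theorem.** The radial limits $a(e^{i\theta})$ exist and satisfy $|a(e^{i\theta})|=\alpha(e^{i\theta})$ for a.e. $\theta$. Let $1<p<\infty$, $\frac1p+\frac1q=1$ and $\phi\in L^p_\alpha(\mathbb T)$. Then for every $g\in H^q_\alpha$ the function $\phi(e^{i\theta})a(e^{i\theta})e^{i\theta}g(e^{i\theta})$ is integrable on $\mathbb T$, and $$\operatorname{dist}(\phi,H^p_\alpha)=\inf_{f\in H^p_\alpha}\|\phi-f\|_{\alpha,p}=\sup_{g\in H^q_\alpha,\ \|g\|_{\alpha,q}=1}\left|\int_{\mathbb T}\phi(e^{i\theta})\,a(e^{i\theta})\,e^{i\theta}\,g(e^{i\theta})\,d\lambda\right| .$$ -/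

import Mathlib

open MeasureTheory Filter Topology Real

noncomputable section

instance two_pi_pos_fact : Fact (0 < 2 * π) := ⟨Real.two_pi_pos⟩

/-- The unit circle `𝕋`, parametrised by the angle `θ ∈ ℝ / 2πℤ`; a function on `𝕋` is written as
a function of `θ`. -/
abbrev UnitCirc : Type := AddCircle (2 * π)

/-- The point `e^{iθ}` of the complex plane. -/
def ei (θ : UnitCirc) : ℂ := (AddCircle.toCircle θ : ℂ)

/-- The normalized Lebesgue measure `λ` on `𝕋`, of total mass `1`. -/
abbrev lam : Measure UnitCirc := AddCircle.haarAddCircle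

/-- The measure `α dλ`. The space `L^p_α(𝕋)` is `Lp ℂ p (weighted α)`. -/
def weighted (α : UnitCirc → ℝ) : Measure UnitCirc :=
  lam.withDensity (fun θ => ENNReal.ofReal (α θ))

/-- `F` is the boundary function of `f : 𝔻 → ℂ`: for `λ`-almost every `θ` the radial limit
`lim_{r → 1⁻} f (r e^{iθ})` exists and equals `F θ`. -/
def HasBoundaryValues (f : ℂ → ℂ) (F : UnitCirc → ℂ) : Prop :=
  ∀ᵐ θ ∂lam, Tendsto (fun r : ℝ => f (r * ei θ)) (𝓝[<] 1) (𝓝 (F θ))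

/-- The radial limit `f (e^{iθ}) = lim_{r → 1⁻} f (r e^{iθ})` (an arbitrary value where there is
no limit). -/
def boundaryValue (f : ℂ → ℂ) (θ : UnitCirc) : ℂ :=
  limUnder (𝓝[<] (1 : ℝ)) (fun r : ℝ => f (r * ei θ))

/-- The Nevanlinna class `N`: holomorphic functions on the unit disk with
`sup_{0 ≤ r < 1} ∫ log⁺ |f (r e^{iθ})| dλ < ∞`. -/
def IsNevanlinna (f : ℂ → ℂ) : Prop :=
  DifferentiableOn ℂ f (Metric.ball 0 1) ∧
  ∃ C : ℝ, ∀ r ∈ Set.Ico (0 : ℝ) 1, ∫ θ, posLog ‖f (r * ei θ)‖ ∂lam ≤ C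

/-- The Smirnov class `N⁺`: functions `f` in `N` with
`lim_{r → 1⁻} ∫ log⁺ |f (r e^{iθ})| dλ = ∫ log⁺ |f (e^{iθ})| dλ`. (Functions in `N` have radial
limits almost everywhere, with `log⁺ |f (e^{iθ})|` integrable.) -/
def IsSmirnov (f : ℂ → ℂ) : Prop :=
  IsNevanlinna f ∧
  Tendsto (fun r : ℝ => ∫ θ, posLog ‖f (r * ei θ)‖ ∂lam) (𝓝[<] 1)
    (𝓝 (∫ θ, posLog ‖boundaryValue f θ‖ ∂lam))

/-- The weighted Hardy space `H^p_α = N⁺ ∩ L^p_α(𝕋)`: the elements of `L^p_α(𝕋)` that are the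
boundary function of a function of the Smirnov class. Its norm is that of `L^p_α(𝕋)`. -/
def HardySpace (α : UnitCirc → ℝ) (p : ENNReal) : Set (Lp ℂ p (weighted α)) :=
  {F | ∃ f : ℂ → ℂ, IsSmirnov f ∧ HasBoundaryValues f F}

/-- `a` is an outer function on the unit disk with boundary modulus `α`, that is
`a = e^{h + ig}` with `h` the Poisson integral of `log α` and `g` a harmonic conjugate of `h`:
`a(z) = γ exp (∫ (e^{iθ} + z) / (e^{iθ} - z) log α(θ) dλ(θ))` for a constant `|γ| = 1`. -/
def IsOuter (α : UnitCirc → ℝ) (a : ℂ → ℂ) : Prop :=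
  ∃ γ : ℂ, ‖γ‖ = 1 ∧ ∀ z ∈ Metric.ball (0 : ℂ) 1,
    a z = γ * Complex.exp (∫ θ, herglotzRieszKernel 0 z (ei θ) * (Real.log (α θ) : ℂ) ∂lam)

end

/-!
The formula is the Hahn–Banach duality between the distance to a subspace and its annihilator; the
content is that the annihilator of `H^p_α` in `L^p_α` is `{φ ↦ ∫ φ a e^{iθ} g dλ : g ∈ H^q_α}`.

Since `|a| = α` on the circle, `k = a e^{iθ} g / α` has the same modulus as `g`, and
`∫ φ a e^{iθ} g dλ = ∫ φ k α dλ` (`integral_twist`, `exists_twist`). So Hölder's inequality bounds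
the pairing by `‖φ‖ ‖g‖`, and two facts remain.

* If `f ∈ H^p_α` and `g ∈ H^q_α`, then `z f a g` vanishes at `0` and its boundary function is
  integrable of mean zero (`integral_hardy_mul_hardy`).
* A functional on `L^p_α` that vanishes on `H^p_α` has a density `k ∈ L^q_α`
  (`exists_dual_repr`, by Radon–Nikodym). It kills `e^{inθ}`, `n ≥ 0`, so the coefficients of
  negative index of `α k e^{-iθ}` vanish, and this is the boundary function of a holomorphic
  Poisson integral; its quotient by `a` is the required `g ∈ H^q_α`
  (`exists_hardy_of_annihilates`).

Both rest on a theory of the Smirnov class in terms of Poisson integrals. By Fatou's theorem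
(`ae_tendsto_poissonInt`), a holomorphic Poisson integral of an integrable function has that
function as its radial limit, and it is a Smirnov function (`isSmirnov_of_poissonInt`). A Smirnov
function satisfies `log |f| ≤ P[log⁺ |F|]` for its boundary function `F`
(`IsSmirnov.norm_le_exp_poissonInt`). Conversely a holomorphic function with a majorant
`log |f| ≤ P[u]`, `u` integrable, and integrable boundary values is the Poisson integral of them
(`eq_poissonInt_of_majorant`). This last property is stable under multiplication by outer
functions, whose modulus is the exponential of a Poisson integral, and it makes `H^p_α` the set of
elements of `L^p_α` with holomorphic Poisson integral (`mem_hardySpace_iff`). As `α` is bounded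
below, `1 / a` is a bounded outer function, which gives the boundary values of `a`.
-/

/-! ### The Poisson integral on the circle -/

theorem norm_ei (θ : UnitCirc) : ‖ei θ‖ = 1 := Circle.norm_coe _

theorem continuous_ei : Continuous ei :=
  continuous_subtype_val.comp AddCircle.continuous_toCircle

theorem ei_coe (t : ℝ) : ei (t : UnitCirc) = circleMap 0 1 t := by
  simp [ei, AddCircle.toCircle_apply_mk, circleMap]

theorem coe_arg_ei (θ : UnitCirc) : ((Complex.arg (ei θ) : ℝ) : UnitCirc) = θ := by
  induction θ using QuotientAddGroup.induction_on with
  | H t =>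
    have h := Complex.arg_cos_add_sin_mul_I_coe_angle (t : Real.Angle)
    rw [show ei (QuotientAddGroup.mk t : UnitCirc) =
        Real.Angle.cos t + Real.Angle.sin t * Complex.I by
      rw [show (QuotientAddGroup.mk t : UnitCirc) = ((t : ℝ) : UnitCirc) from rfl, ei_coe]
      simp [circleMap, Complex.exp_mul_I]]
    exact h

theorem ei_nat (n : ℕ) (θ : UnitCirc) : fourier (n : ℤ) θ = ei θ ^ n := by
  rw [fourier_apply, natCast_zsmul, AddCircle.toCircle_nsmul, Circle.coe_pow]; rfl

section Average

variable {E : Type*} [NormedAddCommGroup E] [NormedSpace ℝ E]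

theorem circleAverage_eq_integral (f : ℂ → E) :
    circleAverage f 0 1 = ∫ θ, f (ei θ) ∂lam := by
  rw [AddCircle.integral_haarAddCircle, ← AddCircle.intervalIntegral_preimage (2 * π) 0,
    circleAverage_def]
  simp [ei_coe]

omit [NormedSpace ℝ E] in
theorem integrable_lam_iff {u : UnitCirc → E} : Integrable u lam ↔ Integrable u volume := by
  rw [AddCircle.volume_eq_smul_haarAddCircle]
  refine (integrable_smul_measure ?_ ENNReal.ofReal_ne_top).symm
  simpa using Real.pi_pos

theorem ae_lam_iff {P : UnitCirc → Prop} :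
    (∀ᵐ θ ∂lam, P θ) ↔ ∀ᵐ θ ∂(volume : Measure UnitCirc), P θ := by
  rw [AddCircle.volume_eq_smul_haarAddCircle, Measure.ae_ennreal_smul_measure_iff]
  simpa using Real.pi_pos

omit [NormedSpace ℝ E] in
/-- An integrable function of the angle, read as a function on the unit circle of `ℂ`. -/
theorem circleIntegrable_comp_arg {u : UnitCirc → E} (hu : Integrable u lam) :
    CircleIntegrable (fun ζ => u ((Complex.arg ζ : ℝ) : UnitCirc)) 0 1 := by
  have h := integrable_lam_iff.1 hu
  have h2 := (AddCircle.measurePreserving_mk (2 * π) 0).integrable_comp_of_integrable h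
  rw [CircleIntegrable, intervalIntegrable_iff, Set.uIoc_of_le Real.two_pi_pos.le]
  rw [zero_add] at h2
  refine h2.congr (ae_of_all _ fun t => ?_)
  simp only [Function.comp_apply]
  rw [← ei_coe, coe_arg_ei]

end Average

/-- The Poisson kernel `P_z(θ) = (1 - |z|²) / |e^{iθ} - z|²`. -/
noncomputable def pk (z : ℂ) (θ : UnitCirc) : ℝ := poissonKernel 0 z (ei θ)

theorem pk_eq (z : ℂ) (θ : UnitCirc) : pk z θ = (1 - ‖z‖ ^ 2) / ‖ei θ - z‖ ^ 2 := by
  simp [pk, poissonKernel_def, norm_ei]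

theorem pk_eq_re (z : ℂ) (θ : UnitCirc) : pk z θ = (herglotzRieszKernel 0 z (ei θ)).re := by
  rw [pk, poissonKernel_eq_re_herglotzRieszKernel]; rfl

theorem ei_sub_ne_zero {z : ℂ} (hz : ‖z‖ < 1) (θ : UnitCirc) : ei θ - z ≠ 0 := by
  intro h
  rw [sub_eq_zero] at h
  rw [← h, norm_ei] at hz
  exact lt_irrefl _ hz

theorem pk_pos {z : ℂ} (hz : ‖z‖ < 1) (θ : UnitCirc) : 0 < pk z θ := by
  rw [pk_eq]
  have := norm_nonneg z
  have h2 := norm_pos_iff.2 (ei_sub_ne_zero hz θ)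
  have : 0 < 1 - ‖z‖ ^ 2 := by nlinarith
  positivity

theorem continuous_herglotz {z : ℂ} (hz : ‖z‖ < 1) :
    Continuous fun θ => herglotzRieszKernel 0 z (ei θ) := by
  simp only [herglotzRieszKernel_def, sub_zero]
  exact (continuous_ei.add continuous_const).div (continuous_ei.sub continuous_const)
    (ei_sub_ne_zero hz)

theorem continuous_pk {z : ℂ} (hz : ‖z‖ < 1) : Continuous (pk z) := by
  simp only [funext (pk_eq_re z)]
  exact Complex.continuous_re.comp (continuous_herglotz hz)

theorem norm_herglotz_le {z : ℂ} (hz : ‖z‖ < 1) (θ : UnitCirc) :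
    ‖herglotzRieszKernel 0 z (ei θ)‖ ≤ 2 / (1 - ‖z‖) := by
  simp only [herglotzRieszKernel_def, sub_zero]
  rw [norm_div]
  have h1 := norm_add_le (ei θ) z
  have h2 := norm_sub_norm_le (ei θ) z
  rw [norm_ei] at h1 h2
  have h3 : 0 < 1 - ‖z‖ := by linarith
  gcongr
  linarith

theorem norm_pk_le {z : ℂ} (hz : ‖z‖ < 1) (θ : UnitCirc) : ‖pk z θ‖ ≤ 2 / (1 - ‖z‖) := by
  rw [pk_eq_re]
  exact (Complex.abs_re_le_norm _).trans (norm_herglotz_le hz θ)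

/-- Interchanging the two angles does not change the Poisson kernel. -/
theorem pk_symm (r : ℝ) (θ η : UnitCirc) : pk (r * ei θ) η = pk (r * ei η) θ := by
  rw [pk_eq, pk_eq, norm_mul, norm_mul, norm_ei, norm_ei]
  have h : ∀ a b : ℂ, ‖a‖ = 1 → ‖b‖ = 1 →
      ‖a - r * b‖ ^ 2 = 1 + r ^ 2 - 2 * r * (a.re * b.re + a.im * b.im) := by
    intro a b ha hb
    have ha2 : a.re ^ 2 + a.im ^ 2 = 1 := by
      have := Complex.sq_norm a; rw [ha, Complex.normSq_apply] at this; nlinarith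
    have hb2 : b.re ^ 2 + b.im ^ 2 = 1 := by
      have := Complex.sq_norm b; rw [hb, Complex.normSq_apply] at this; nlinarith
    rw [Complex.sq_norm, Complex.normSq_apply]
    simp only [Complex.sub_re, Complex.mul_re, Complex.ofReal_re, Complex.ofReal_im, Complex.sub_im,
      Complex.mul_im]
    linear_combination ha2 + r ^ 2 * hb2
  have e : ‖ei η - r * ei θ‖ ^ 2 = ‖ei θ - r * ei η‖ ^ 2 := by
    rw [h _ _ (norm_ei _) (norm_ei _), h _ _ (norm_ei _) (norm_ei _)]; ring
  rw [e]

section Poisson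

variable {E : Type*} [NormedAddCommGroup E] [NormedSpace ℝ E]

/-- The Poisson integral `P[u](z) = ∫ P_z u dλ` of a function on the circle. -/
noncomputable def poissonInt (u : UnitCirc → E) (z : ℂ) : E := ∫ θ, pk z θ • u θ ∂lam

theorem integrable_pk_smul {u : UnitCirc → E} (hu : Integrable u lam) {z : ℂ} (hz : ‖z‖ < 1) :
    Integrable (fun θ => pk z θ • u θ) lam :=
  hu.bdd_smul (2 / (1 - ‖z‖)) (continuous_pk hz).aestronglyMeasurable
    (ae_of_all _ (norm_pk_le hz))

theorem poissonInt_congr {u v : UnitCirc → E} (h : u =ᵐ[lam] v) (z : ℂ) :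
    poissonInt u z = poissonInt v z :=
  integral_congr_ae (h.mono fun θ hθ => by simp only [hθ])

theorem poissonInt_add {u v : UnitCirc → E} (hu : Integrable u lam) (hv : Integrable v lam)
    {z : ℂ} (hz : ‖z‖ < 1) :
    poissonInt (fun θ => u θ + v θ) z = poissonInt u z + poissonInt v z := by
  simp only [poissonInt, smul_add]
  exact integral_add (integrable_pk_smul hu hz) (integrable_pk_smul hv hz)

theorem poissonInt_sub {u v : UnitCirc → E} (hu : Integrable u lam) (hv : Integrable v lam)
    {z : ℂ} (hz : ‖z‖ < 1) :
    poissonInt (fun θ => u θ - v θ) z = poissonInt u z - poissonInt v z := by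
  simp only [poissonInt, smul_sub]
  exact integral_sub (integrable_pk_smul hu hz) (integrable_pk_smul hv hz)

theorem norm_poissonInt_le (u : UnitCirc → E) {z : ℂ} (hz : ‖z‖ < 1) :
    ‖poissonInt u z‖ ≤ poissonInt (fun θ => ‖u θ‖) z := by
  refine (norm_integral_le_integral_norm _).trans_eq (integral_congr_ae (ae_of_all _ fun θ => ?_))
  simp only [norm_smul, Real.norm_of_nonneg (pk_pos hz θ).le, smul_eq_mul]

theorem poissonInt_mono {u v : UnitCirc → ℝ} (hu : Integrable u lam) (hv : Integrable v lam)
    (h : u ≤ᵐ[lam] v) {z : ℂ} (hz : ‖z‖ < 1) : poissonInt u z ≤ poissonInt v z :=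
  integral_mono_ae (integrable_pk_smul hu hz) (integrable_pk_smul hv hz)
    (h.mono fun θ hθ => mul_le_mul_of_nonneg_left hθ (pk_pos hz θ).le)

/-- The Poisson integral formula: a function holomorphic on the disk and continuous up to the
circle is the Poisson integral of its boundary function. -/
theorem poissonInt_of_diffContOnCl {f : ℂ → ℂ} (hf : DiffContOnCl ℂ f (Metric.ball 0 1))
    {z : ℂ} (hz : ‖z‖ < 1) : poissonInt (fun θ => f (ei θ)) z = f z := by
  rw [← hf.circleAverage_poissonKernel_smul (by simpa using hz), circleAverage_eq_integral]
  rfl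

theorem integral_pk {z : ℂ} (hz : ‖z‖ < 1) : ∫ θ, pk z θ ∂lam = 1 := by
  have h := poissonInt_of_diffContOnCl (f := fun _ => 1) diffContOnCl_const hz
  simp only [poissonInt, Complex.real_smul, mul_one] at h
  rw [integral_complex_ofReal] at h
  exact_mod_cast h

theorem poissonInt_const [CompleteSpace E] (c : E) {z : ℂ} (hz : ‖z‖ < 1) :
    poissonInt (fun _ => c) z = c := by
  rw [poissonInt, integral_smul_const, integral_pk hz, one_smul]

theorem pk_zero (θ : UnitCirc) : pk 0 θ = 1 := by simp [pk_eq, norm_ei]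

theorem poissonInt_zero (u : UnitCirc → E) : poissonInt u 0 = ∫ θ, u θ ∂lam := by
  simp [poissonInt, pk_zero]

end Poisson

theorem norm_mul_ei_lt {r : ℝ} (h0 : 0 ≤ r) (h1 : r < 1) (θ : UnitCirc) : ‖(r : ℂ) * ei θ‖ < 1 := by
  rw [norm_mul, norm_ei, Complex.norm_real, Real.norm_of_nonneg h0, mul_one]; exact h1

/-! ### Herglotz integrals and outer functions -/

/-- The Herglotz integral `∫ (e^{iθ} + z) / (e^{iθ} - z) v(θ) dλ(θ)`. -/
noncomputable def herglotzInt (v : UnitCirc → ℝ) (z : ℂ) : ℂ :=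
  ∫ θ, herglotzRieszKernel 0 z (ei θ) * (v θ : ℂ) ∂lam

theorem differentiableOn_herglotz {u : UnitCirc → ℂ} (hu : Integrable u lam) :
    DifferentiableOn ℂ (fun z => ∫ θ, herglotzRieszKernel 0 z (ei θ) * u θ ∂lam)
      (Metric.ball 0 1) := by
  have h := differentiableOn_circleAverage_herglotzRieszKernel_smul (circleIntegrable_comp_arg hu)
  refine h.congr fun z _ => ?_
  rw [circleAverage_eq_integral]
  simp only [coe_arg_ei, smul_eq_mul]

theorem differentiableOn_herglotzInt {v : UnitCirc → ℝ} (hv : Integrable v lam) :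
    DifferentiableOn ℂ (herglotzInt v) (Metric.ball 0 1) :=
  differentiableOn_herglotz hv.ofReal

theorem integrable_herglotz_mul {u : UnitCirc → ℂ} (hu : Integrable u lam) {z : ℂ}
    (hz : ‖z‖ < 1) : Integrable (fun θ => herglotzRieszKernel 0 z (ei θ) * u θ) lam :=
  hu.bdd_mul (continuous_herglotz hz).aestronglyMeasurable (ae_of_all _ (norm_herglotz_le hz))

theorem re_herglotzInt {v : UnitCirc → ℝ} (hv : Integrable v lam) {z : ℂ} (hz : ‖z‖ < 1) :
    (herglotzInt v z).re = poissonInt v z := by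
  have h := Complex.reCLM.integral_comp_comm (integrable_herglotz_mul hv.ofReal hz)
  refine h.symm.trans ?_
  refine integral_congr_ae (ae_of_all _ fun θ => ?_)
  simp [pk_eq_re]

/-! ### Fatou's theorem on radial limits of Poisson integrals -/

theorem norm_ei_sub_ge (θ η : UnitCirc) : 2 / π * dist θ η ≤ ‖ei θ - ei η‖ := by
  have h1 : ∀ t : UnitCirc, 2 / π * ‖t‖ ≤ ‖ei t - 1‖ := by
    intro t
    induction t using QuotientAddGroup.induction_on with
    | H s =>
      have key : ∀ s : ℝ, |s| ≤ π → 2 / π * |s| ≤ ‖ei (s : UnitCirc) - 1‖ := by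
        intro s hs
        rw [ei_coe]
        have := Complex.norm_exp_I_mul_ofReal_sub_one s
        have h2 := Real.mul_abs_le_abs_sin (x := s / 2) (by rw [abs_div, abs_two]; linarith)
        have e : circleMap 0 1 s = Complex.exp (Complex.I * s) := by
          simp [circleMap, mul_comm]
        rw [e, this, Real.norm_eq_abs, abs_mul, abs_two]
        rw [abs_div, abs_two] at h2
        linarith
      obtain ⟨s', hs', hs⟩ : ∃ s' : ℝ, |s'| = ‖((s : ℝ) : UnitCirc)‖ ∧
          ((s' : ℝ) : UnitCirc) = (s : UnitCirc) := by
        refine ⟨s - round ((2 * π)⁻¹ * s) * (2 * π), (AddCircle.norm_eq _).symm, ?_⟩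
        have : ((round ((2 * π)⁻¹ * s) * (2 * π) : ℝ) : UnitCirc) = 0 := by
          rw [← zsmul_eq_mul]
          exact AddCircle.coe_eq_zero_iff _ |>.2 ⟨_, rfl⟩
        rw [AddCircle.coe_sub, this, sub_zero]
      have hn := AddCircle.norm_le_half_period (2 * π) (x := ((s : ℝ) : UnitCirc))
        Real.two_pi_pos.ne'
      rw [abs_of_pos Real.two_pi_pos] at hn
      have := key s' (by rw [hs']; linarith)
      rw [hs', hs] at this
      exact this
  have h2 : ei θ - ei η = ei η * (ei (θ - η) - 1) := by
    have : ei η * ei (θ - η) = ei θ := by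
      rw [ei, ei, ei, ← Circle.coe_mul, ← AddCircle.toCircle_add]
      simp
    rw [mul_sub, this, mul_one]
  rw [h2, norm_mul, norm_ei, one_mul, dist_eq_norm]
  exact h1 _

theorem norm_sub_mul_ei_sq {r : ℝ} (θ η : UnitCirc) :
    ‖ei θ - r * ei η‖ ^ 2 = (1 - r) ^ 2 + r * ‖ei θ - ei η‖ ^ 2 := by
  have hn : ∀ t, (ei t).re ^ 2 + (ei t).im ^ 2 = 1 := by
    intro t
    have := Complex.sq_norm (ei t)
    rw [norm_ei, Complex.normSq_apply] at this
    nlinarith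
  have ha := hn θ
  have hb := hn η
  rw [Complex.sq_norm, Complex.sq_norm, Complex.normSq_apply, Complex.normSq_apply]
  simp only [Complex.sub_re, Complex.mul_re, Complex.ofReal_re, Complex.ofReal_im, Complex.sub_im,
    Complex.mul_im]
  linear_combination (1 - r) * ha + (r ^ 2 - r) * hb

/-- The constant absorbs Jordan's inequality `2 / π * dist θ η ≤ |e^{iθ} - e^{iη}|` and `r ≥ 1 / 2`. -/
theorem pk_le_div {r : ℝ} (hr : 1 / 2 ≤ r) (hr1 : r < 1) (θ η : UnitCirc) :
    pk (r * ei η) θ ≤ 10 * (1 - r) / ((1 - r) ^ 2 + dist θ η ^ 2) := by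
  rw [pk_eq, norm_mul, norm_ei, Complex.norm_real, Real.norm_of_nonneg (by linarith), mul_one,
    norm_sub_mul_ei_sq]
  have h := norm_ei_sub_ge θ η
  have hd : 0 ≤ dist θ η := dist_nonneg
  have hpi : 2 / π ≥ 0.634 := by
    rw [ge_iff_le, le_div_iff₀ Real.pi_pos]
    have := Real.pi_lt_d2
    linarith
  have h1 : 0.634 * dist θ η ≤ ‖ei θ - ei η‖ := le_trans (by gcongr) h
  have h2 : (0.634 * dist θ η) ^ 2 ≤ ‖ei θ - ei η‖ ^ 2 := by gcongr
  have h3 : 0 < 1 - r := by linarith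
  rw [div_le_div_iff₀ (by positivity) (by positivity)]
  have h4 : (1 - r) ^ 2 + dist θ η ^ 2 ≤ 5 * ((1 - r) ^ 2 + r * ‖ei θ - ei η‖ ^ 2) := by
    nlinarith [sq_nonneg (dist θ η), sq_nonneg (1 - r)]
  calc (1 - r ^ 2) * ((1 - r) ^ 2 + dist θ η ^ 2)
      ≤ (2 * (1 - r)) * (5 * ((1 - r) ^ 2 + r * ‖ei θ - ei η‖ ^ 2)) := by
        gcongr
        nlinarith
    _ = _ := by ring

/-- The Poisson kernel is dominated by a superposition of indicators of the balls of radius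
`2 ^ k δ`, where `δ = 1 - r`, with weights `4 ^ (-k) / δ`. -/
theorem pk_le_tsum {r : ℝ} (hr : 1 / 2 ≤ r) (hr1 : r < 1) (θ η : UnitCirc) :
    pk (r * ei η) θ ≤ ∑' k : ℕ, 40 / (1 - r) * (1 / 4) ^ k *
      (Metric.closedBall η (2 ^ k * (1 - r))).indicator (fun _ => 1) θ := by
  have hδ : 0 < 1 - r := by linarith
  have hnn : ∀ k : ℕ, 0 ≤ 40 / (1 - r) * (1 / 4) ^ k *
      (Metric.closedBall η (2 ^ k * (1 - r))).indicator (fun _ => (1 : ℝ)) θ := fun k =>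
    mul_nonneg (by positivity) (Set.indicator_nonneg (fun _ _ => zero_le_one) _)
  have hs : Summable fun k : ℕ => 40 / (1 - r) * (1 / 4) ^ k *
      (Metric.closedBall η (2 ^ k * (1 - r))).indicator (fun _ => (1 : ℝ)) θ := by
    refine Summable.of_nonneg_of_le hnn (fun k => ?_)
      ((summable_geometric_of_lt_one (by norm_num) (by norm_num : (1 / 4 : ℝ) < 1)).mul_left
        (40 / (1 - r)))
    refine mul_le_of_le_one_right (by positivity) ?_
    exact Set.indicator_le_self' (fun _ _ => zero_le_one) _
  have hex : ∃ k : ℕ, dist θ η ≤ 2 ^ k * (1 - r) := by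
    obtain ⟨k, hk⟩ := pow_unbounded_of_one_lt (dist θ η / (1 - r)) one_lt_two
    exact ⟨k, ((div_lt_iff₀ hδ).1 hk).le⟩
  classical
  set k := Nat.find hex with hkdef
  have hk : dist θ η ≤ 2 ^ k * (1 - r) := Nat.find_spec hex
  refine (pk_le_div hr hr1 θ η).trans (le_trans ?_ (hs.le_tsum k fun j _ => hnn j))
  rw [Set.indicator_of_mem (by simpa using hk), mul_one]
  rcases Nat.eq_zero_or_pos k with h0 | hpos
  · rw [h0, pow_zero, mul_one, div_le_div_iff₀ (by positivity) hδ]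
    nlinarith [sq_nonneg (dist θ η), sq_nonneg (1 - r)]
  · obtain ⟨m, hm⟩ := Nat.exists_eq_succ_of_ne_zero hpos.ne'
    have hmin : 2 ^ m * (1 - r) < dist θ η := by
      have := Nat.find_min hex (m := m) (by rw [← hkdef, hm]; exact Nat.lt_succ_self m)
      exact not_le.1 this
    rw [hm, div_mul_eq_mul_div, div_le_div_iff₀ (by positivity) hδ]
    have h2 : (2 ^ m * (1 - r)) ^ 2 ≤ dist θ η ^ 2 := by gcongr
    have h3 : (1 / 4 : ℝ) ^ (m + 1) * (2 ^ m) ^ 2 = 1 / 4 := by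
      rw [← pow_mul, mul_comm m 2, pow_mul, pow_succ, mul_right_comm, ← mul_pow]
      norm_num
    calc 10 * (1 - r) * (1 - r) = 40 * ((1 / 4) ^ (m + 1) * (2 ^ m) ^ 2) * (1 - r) ^ 2 := by
          rw [h3]; ring
      _ = 40 * (1 / 4) ^ (m + 1) * (2 ^ m * (1 - r)) ^ 2 := by ring
      _ ≤ 40 * (1 / 4) ^ (m + 1) * ((1 - r) ^ 2 + dist θ η ^ 2) := by
          gcongr
          nlinarith [sq_nonneg (1 - r)]

section

variable {E : Type*} [NormedAddCommGroup E]

/-- At almost every `η`, the mean oscillations of an integrable function about its value at `η`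
over balls of radius `ρ` tend to `0` with `ρ`. -/
theorem ae_tendsto_oscillation {u : UnitCirc → E} (hu : Integrable u lam) :
    ∀ᵐ η ∂lam, Tendsto
      (fun ρ : ℝ => ρ⁻¹ * ∫ θ in Metric.closedBall η ρ, ‖u θ - u η‖ ∂lam) (𝓝[>] 0) (𝓝 0) := by
  rw [ae_lam_iff]
  have hloc : LocallyIntegrable u (volume : Measure UnitCirc) :=
    (integrable_lam_iff.1 hu).locallyIntegrable
  filter_upwards [IsUnifLocDoublingMeasure.ae_tendsto_average_norm_sub volume hloc 1] with η hη
  have h := hη (fun _ => η) (fun ρ : ℝ => ρ) tendsto_id (by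
    filter_upwards [self_mem_nhdsWithin] with ρ hρ
    simpa using (Set.mem_Ioi.1 hρ).le)
  have h2 : Tendsto (fun ρ : ℝ => π⁻¹ * ⨍ θ in Metric.closedBall η ρ, ‖u θ - u η‖) (𝓝[>] 0)
      (𝓝 0) := by simpa using h.const_mul π⁻¹
  refine h2.congr' ?_
  filter_upwards [Ioo_mem_nhdsGT Real.pi_pos] with ρ hρ
  have hv : volume.real (Metric.closedBall η ρ) = 2 * ρ := by
    rw [Measure.real, AddCircle.volume_closedBall, min_eq_right (by linarith [hρ.2]),
      ENNReal.toReal_ofReal (by linarith [hρ.1])]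
  rw [setAverage_eq, hv, AddCircle.volume_eq_smul_haarAddCircle, Measure.restrict_smul,
    integral_smul_measure, ENNReal.toReal_ofReal Real.two_pi_pos.le, smul_eq_mul, smul_eq_mul]
  have := hρ.1.ne'
  field_simp

/-- The Poisson integral tends to zero at a point where the mean oscillation does: the dyadic bound
for the kernel gives a series of mean oscillations over balls of radius `2 ^ k (1 - r)`, whose
terms tend to zero and are dominated by a geometric series. -/
theorem tendsto_poissonInt_norm_sub {u : UnitCirc → E} (hu : Integrable u lam) {η : UnitCirc}
    (hη : Tendsto (fun ρ : ℝ => ρ⁻¹ * ∫ θ in Metric.closedBall η ρ, ‖u θ - u η‖ ∂lam)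
      (𝓝[>] 0) (𝓝 0)) :
    Tendsto (fun r : ℝ => poissonInt (fun θ => ‖u θ - u η‖) (r * ei η)) (𝓝[<] 1) (𝓝 0) := by
  set w : UnitCirc → ℝ := fun θ => ‖u θ - u η‖ with hw
  have hwi : Integrable w lam := (hu.sub (integrable_const _)).norm
  set A : ℝ → ℝ := fun ρ => ρ⁻¹ * ∫ θ in Metric.closedBall η ρ, w θ ∂lam with hA
  have hA0 : ∀ ρ, 0 < ρ → 0 ≤ A ρ := fun ρ hρ =>
    mul_nonneg (inv_nonneg.2 hρ.le) (integral_nonneg fun _ => norm_nonneg _)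
  obtain ⟨M, hM⟩ : ∃ M, ∀ ρ, 0 < ρ → A ρ ≤ M := by
    obtain ⟨ρ₀, hρ₀, h1⟩ : ∃ ρ₀ > 0, ∀ ρ ∈ Set.Ioo (0 : ℝ) ρ₀, A ρ < 1 := by
      have := hη.eventually_lt_const zero_lt_one
      obtain ⟨ρ₀, hρ₀, h⟩ := mem_nhdsGT_iff_exists_Ioo_subset.1 this
      exact ⟨ρ₀, hρ₀, fun ρ hρ => h hρ⟩
    refine ⟨max 1 (ρ₀⁻¹ * ∫ θ, w θ ∂lam), fun ρ hρ => ?_⟩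
    rcases lt_or_ge ρ ρ₀ with h | h
    · exact (h1 ρ ⟨hρ, h⟩).le.trans (le_max_left _ _)
    · refine le_trans ?_ (le_max_right _ _)
      exact mul_le_mul (inv_anti₀ hρ₀ h)
        (setIntegral_le_integral hwi (ae_of_all _ fun _ => norm_nonneg _))
        (integral_nonneg fun _ => norm_nonneg _) (inv_nonneg.2 hρ₀.le)
  -- the dyadic majorant of the Poisson integral
  have hbound : ∀ r : ℝ, 1 / 2 ≤ r → r < 1 →
      poissonInt w (r * ei η) ≤ ∑' k : ℕ, 40 * (1 / 2) ^ k * A (2 ^ k * (1 - r)) := by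
    intro r hr hr1
    have hδ : 0 < 1 - r := by linarith
    set F : ℕ → UnitCirc → ℝ := fun k θ => 40 / (1 - r) * (1 / 4) ^ k *
      (Metric.closedBall η (2 ^ k * (1 - r))).indicator w θ with hF
    have hFint : ∀ k, Integrable (F k) lam := fun k =>
      (hwi.indicator Metric.isClosed_closedBall.measurableSet).const_mul _
    have hFnn : ∀ k θ, 0 ≤ F k θ := fun k θ =>
      mul_nonneg (by positivity) (Set.indicator_nonneg (fun _ _ => norm_nonneg _) _)
    have hFv : ∀ k, ∫ θ, F k θ ∂lam = 40 * (1 / 2) ^ k * A (2 ^ k * (1 - r)) := by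
      intro k
      rw [hF, integral_const_mul, integral_indicator Metric.isClosed_closedBall.measurableSet, hA]
      have : (1 / 4 : ℝ) ^ k = (1 / 2) ^ k * (1 / 2) ^ k := by rw [← mul_pow]; norm_num
      simp only [this]
      have h2 : (1 / 2 : ℝ) ^ k = (2 ^ k)⁻¹ := by rw [one_div, inv_pow]
      rw [h2, mul_inv]
      field_simp
    have hsum : Summable fun k => ∫ θ, ‖F k θ‖ ∂lam := by
      have e : (fun k => ∫ θ, ‖F k θ‖ ∂lam) = fun k => 40 * (1 / 2) ^ k * A (2 ^ k * (1 - r)) := by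
        funext k
        rw [← hFv k]
        exact integral_congr_ae (ae_of_all _ fun θ => Real.norm_of_nonneg (hFnn k θ))
      rw [e]
      refine Summable.of_nonneg_of_le
        (fun k => mul_nonneg (by positivity) (hA0 _ (by positivity)))
        (fun k => mul_le_mul_of_nonneg_left (hM _ (by positivity)) (by positivity)) ?_
      exact ((summable_geometric_of_lt_one (by norm_num) (by norm_num)).mul_left 40).mul_right M
    have hs := hasSum_integral_of_summable_integral_norm hFint hsum
    have hz := norm_mul_ei_lt (by linarith : 0 ≤ r) hr1 η
    have hle : ∀ θ, pk (r * ei η) θ • w θ ≤ ∑' k, F k θ := by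
      intro θ
      refine (mul_le_mul_of_nonneg_right (pk_le_tsum hr hr1 θ η) (norm_nonneg _)).trans_eq ?_
      rw [← tsum_mul_right]
      refine tsum_congr fun k => ?_
      by_cases h : θ ∈ Metric.closedBall η (2 ^ k * (1 - r)) <;> simp [hF, h, hw]
    have hI : Integrable (fun θ => ∑' k, F k θ) lam := by
      have hg := (summable_geometric_of_lt_one (by norm_num) (by norm_num : (1 / 4 : ℝ) < 1)).mul_left
        (40 / (1 - r))
      have hFle : ∀ k θ, F k θ ≤ 40 / (1 - r) * (1 / 4) ^ k * w θ := fun k θ =>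
        mul_le_mul_of_nonneg_left (Set.indicator_le_self' (fun _ _ => norm_nonneg _) _)
          (by positivity)
      have hFs : ∀ θ, Summable fun k => F k θ := fun θ =>
        Summable.of_nonneg_of_le (fun k => hFnn k θ) (fun k => hFle k θ) (hg.mul_right (w θ))
      refine (hwi.const_mul (∑' k : ℕ, 40 / (1 - r) * (1 / 4) ^ k)).mono' ?_
        (ae_of_all _ fun θ => ?_)
      · refine aestronglyMeasurable_of_tendsto_ae atTop
          (f := fun n θ => ∑ k ∈ Finset.range n, F k θ) (fun n => ?_)
          (ae_of_all _ fun θ => (hFs θ).hasSum.tendsto_sum_nat)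
        exact (integrable_finsetSum _ fun k _ => hFint k).aestronglyMeasurable
      · rw [Real.norm_of_nonneg (tsum_nonneg fun k => hFnn k θ), ← tsum_mul_right]
        exact (hFs θ).tsum_le_tsum (fun k => hFle k θ) (hg.mul_right (w θ))
    rw [show (∑' k : ℕ, 40 * (1 / 2) ^ k * A (2 ^ k * (1 - r))) = ∫ θ, ∑' k, F k θ ∂lam by
      rw [← hs.tsum_eq]; exact tsum_congr fun k => (hFv k).symm]
    exact integral_mono (integrable_pk_smul hwi hz) hI hle
  have hlim : Tendsto (fun r : ℝ => ∑' k : ℕ, 40 * (1 / 2) ^ k * A (2 ^ k * (1 - r))) (𝓝[<] 1)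
      (𝓝 (∑' _ : ℕ, 0)) := by
    refine tendsto_tsum_of_dominated_convergence (bound := fun k : ℕ => 40 * (1 / 2) ^ k * M)
      (((summable_geometric_of_lt_one (by norm_num) (by norm_num)).mul_left 40).mul_right M)
      (fun k => ?_) ?_
    · have h1 : Tendsto (fun r : ℝ => (2 : ℝ) ^ k * (1 - r)) (𝓝[<] 1) (𝓝[>] 0) := by
        refine tendsto_nhdsWithin_iff.2 ⟨?_, ?_⟩
        · have : Tendsto (fun r : ℝ => (2 : ℝ) ^ k * (1 - r)) (𝓝 1) (𝓝 (2 ^ k * (1 - 1))) :=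
            Continuous.tendsto (by fun_prop) 1
          simpa using this.mono_left nhdsWithin_le_nhds
        · filter_upwards [self_mem_nhdsWithin] with r hr
          have : r < 1 := hr
          exact mul_pos (pow_pos two_pos k) (sub_pos.2 this)
      simpa only [mul_zero, Function.comp_def] using (hη.comp h1).const_mul (40 * (1 / 2) ^ k)
    · filter_upwards [self_mem_nhdsWithin] with r hr k
      have h1 : 0 < 1 - r := sub_pos.2 hr
      have h2 : (0 : ℝ) < 2 ^ k * (1 - r) := by positivity
      rw [Real.norm_of_nonneg (mul_nonneg (by positivity) (hA0 _ h2))]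
      exact mul_le_mul_of_nonneg_left (hM _ h2) (by positivity)
  rw [tsum_zero] at hlim
  have hev : ∀ᶠ r : ℝ in 𝓝[<] 1, 1 / 2 ≤ r ∧ r < 1 := by
    filter_upwards [Ioo_mem_nhdsLT (show (1 / 2 : ℝ) < 1 by norm_num)] with r hr
    exact ⟨hr.1.le, hr.2⟩
  refine tendsto_of_tendsto_of_tendsto_of_le_of_le' tendsto_const_nhds hlim ?_ ?_
  · filter_upwards [hev] with r hr
    exact integral_nonneg fun θ => mul_nonneg
      (pk_pos (norm_mul_ei_lt (by linarith [hr.1]) hr.2 η) θ).le (norm_nonneg _)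
  · filter_upwards [hev] with r hr using hbound r hr.1 hr.2

variable [NormedSpace ℝ E]

/-- **Fatou's theorem**: the Poisson integral of an integrable function has radial limits equal to
the function, almost everywhere. -/
theorem ae_tendsto_poissonInt [CompleteSpace E] {u : UnitCirc → E} (hu : Integrable u lam) :
    ∀ᵐ η ∂lam, Tendsto (fun r : ℝ => poissonInt u (r * ei η)) (𝓝[<] 1) (𝓝 (u η)) := by
  filter_upwards [ae_tendsto_oscillation hu] with η hη
  rw [tendsto_iff_norm_sub_tendsto_zero]
  refine squeeze_zero' (Eventually.of_forall fun _ => norm_nonneg _) ?_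
    (tendsto_poissonInt_norm_sub hu hη)
  filter_upwards [Ioo_mem_nhdsLT (zero_lt_one' ℝ)] with r hr
  have hz := norm_mul_ei_lt hr.1.le hr.2 η
  have : poissonInt u (r * ei η) - u η = poissonInt (fun θ => u θ - u η) (r * ei η) := by
    rw [poissonInt_sub hu (integrable_const _) hz, poissonInt_const _ hz]
  rw [this]
  exact norm_poissonInt_le _ hz

end

/-! ### Bounded holomorphic functions -/

theorem poissonInt_ei_pow (n : ℕ) {z : ℂ} (hz : ‖z‖ < 1) :
    poissonInt (fun θ => ei θ ^ n) z = z ^ n :=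
  poissonInt_of_diffContOnCl (f := fun ζ => ζ ^ n)
    (Differentiable.diffContOnCl (by fun_prop)) hz

/-- The monomials `e^{inθ}`, `n ≥ 0`, in `L²(𝕋)`. -/
noncomputable def monomialL2 (n : ℕ) : Lp ℂ 2 lam := fourierLp 2 (n : ℤ)

theorem orthonormal_monomialL2 : Orthonormal ℂ monomialL2 :=
  orthonormal_fourier.comp (fun n : ℕ => (n : ℤ)) Nat.cast_injective

theorem coeFn_monomialL2 (n : ℕ) : monomialL2 n =ᵐ[lam] fun θ => ei θ ^ n := by
  filter_upwards [coeFn_fourierLp (T := 2 * π) 2 (n : ℤ)] with θ hθ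
  rw [monomialL2, hθ, ei_nat]

/-- The Taylor coefficients of a function bounded by `M` in the disk are square summable, with sum
at most `M ^ 2`; this is Bessel's inequality on the circles of radius `r < 1`. -/
theorem sum_sq_taylorCoeff_le {h : ℂ → ℂ} {c : ℕ → ℂ}
    (hc : ∀ z : ℂ, ‖z‖ < 1 → HasSum (fun n => c n * z ^ n) (h z)) {M : ℝ} (hM0 : 0 ≤ M)
    (hM : ∀ z : ℂ, ‖z‖ < 1 → ‖h z‖ ≤ M) (s : Finset ℕ) : ∑ n ∈ s, ‖c n‖ ^ 2 ≤ M ^ 2 := by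
  have key : ∀ r : ℝ, 0 < r → r < 1 → ∑ n ∈ s, ‖c n * r ^ n‖ ^ 2 ≤ M ^ 2 := by
    intro r h0 h1
    have hr : ‖(r : ℂ)‖ < 1 := by rwa [Complex.norm_real, Real.norm_of_nonneg h0.le]
    set g : ℕ → C(UnitCirc, ℂ) := fun n => (c n * r ^ n) • fourier (n : ℤ) with hg
    have hgs : Summable g := by
      refine Summable.of_norm ?_
      simp only [hg, norm_smul, fourier_norm, mul_one]
      exact (hc r hr).summable.norm
    have hval : ∀ θ, (∑' n, g n) θ = h (r * ei θ) := by
      intro θ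
      have h3 := ContinuousMap.hasSum_apply hgs.hasSum θ
      have h2 := hc (r * ei θ) (norm_mul_ei_lt h0.le h1 θ)
      refine h3.unique (h2.congr_fun ?_)
      intro n
      simp only [hg, ContinuousMap.smul_apply, smul_eq_mul, ei_nat]
      ring
    set T := ContinuousMap.toLp (E := ℂ) 2 lam ℂ
    have hT : HasSum (fun n => (c n * r ^ n) • monomialL2 n) (T (∑' n, g n)) := by
      have := hgs.hasSum.mapL T
      refine this.congr_fun fun n => ?_
      rw [hg, map_smul]
      rfl
    have hcoef : ∀ m, inner ℂ (monomialL2 m) (T (∑' n, g n)) = c m * r ^ m := by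
      intro m
      have h3 := hT.mapL (innerSL ℂ (monomialL2 m))
      have h4 : HasSum (fun n => innerSL ℂ (monomialL2 m) ((c n * r ^ n) • monomialL2 n))
          (c m * r ^ m) := by
        convert hasSum_single m (f := fun n => innerSL ℂ (monomialL2 m)
          ((c n * (r : ℂ) ^ n) • monomialL2 n)) ?_ using 1
        · simp [orthonormal_monomialL2.1 m]
        · intro n hn
          simp [orthonormal_monomialL2.2 hn.symm]
      exact h3.unique h4
    have hB := orthonormal_monomialL2.sum_inner_products_le (T (∑' n, g n)) (s := s)
    simp only [hcoef] at hB
    refine hB.trans ?_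
    gcongr
    have := Lp.norm_le_of_ae_bound (f := T (∑' n, g n)) hM0 (by
      filter_upwards [ContinuousMap.coeFn_toLp (p := 2) lam (𝕜 := ℂ) (∑' n, g n)] with θ hθ
      rw [hθ, hval]
      exact hM _ (norm_mul_ei_lt h0.le h1 θ))
    simpa [measureUnivNNReal] using this
  have hlim : Tendsto (fun r : ℝ => ∑ n ∈ s, ‖c n * r ^ n‖ ^ 2) (𝓝[<] 1)
      (𝓝 (∑ n ∈ s, ‖c n * (1 : ℝ) ^ n‖ ^ 2)) :=
    (Continuous.tendsto (by fun_prop) 1).mono_left nhdsWithin_le_nhds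
  simp only [Complex.ofReal_one, one_pow, mul_one] at hlim
  refine le_of_tendsto hlim ?_
  filter_upwards [Ioo_mem_nhdsLT (zero_lt_one' ℝ)] with r hr using key r hr.1 hr.2

/-- A bounded holomorphic function on the disk is the Poisson integral of an integrable function:
its Taylor coefficients are square summable, hence the Fourier coefficients of an `L²` function. -/
theorem exists_eq_poissonInt_of_bounded {h : ℂ → ℂ} (hd : DifferentiableOn ℂ h (Metric.ball 0 1))
    {M : ℝ} (hM : ∀ z : ℂ, ‖z‖ < 1 → ‖h z‖ ≤ M) :
    ∃ H : UnitCirc → ℂ, Integrable H lam ∧ ∀ z : ℂ, ‖z‖ < 1 → h z = poissonInt H z := by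
  have hM0 : 0 ≤ M := (norm_nonneg _).trans (hM 0 (by simp))
  set c : ℕ → ℂ := fun n => (n.factorial : ℂ)⁻¹ * iteratedDeriv n h 0 with hcdef
  have hc : ∀ z : ℂ, ‖z‖ < 1 → HasSum (fun n => c n * z ^ n) (h z) := by
    intro z hz
    refine (Complex.hasSum_taylorSeries_on_ball hd (by simpa using hz)).congr_fun fun n => ?_
    simp only [hcdef, smul_eq_mul, sub_zero]
    ring
  have hsq : Summable fun n => ‖c n‖ ^ 2 :=
    summable_of_sum_le (fun n => by positivity) (sum_sq_taylorCoeff_le hc hM0 hM)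
  have hsum : Summable fun n => c n • monomialL2 n := by
    have := (orthonormal_monomialL2.orthogonalFamily.summable_iff_norm_sq_summable c).2 hsq
    simpa using this
  refine ⟨(∑' n, c n • monomialL2 n : Lp ℂ 2 lam), (Lp.memLp _).integrable one_le_two, ?_⟩
  intro z hz
  have hcont : Continuous fun θ => ((pk z θ : ℝ) : ℂ) :=
    Complex.continuous_ofReal.comp (continuous_pk hz)
  have hmem : MemLp (fun θ => ((pk z θ : ℝ) : ℂ)) 2 lam :=
    MemLp.of_bound hcont.aestronglyMeasurable (2 / (1 - ‖z‖))
      (ae_of_all _ fun θ => by simpa using norm_pk_le hz θ)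
  have hP : ∀ F : Lp ℂ 2 lam, inner ℂ (hmem.toLp _) F = poissonInt F z := by
    intro F
    rw [L2.inner_def, poissonInt]
    refine integral_congr_ae ?_
    filter_upwards [hmem.coeFn_toLp] with θ hθ
    rw [hθ, RCLike.inner_apply, Complex.conj_ofReal, Complex.real_smul, mul_comm]
  rw [← hP]
  have h1 := hsum.hasSum.mapL (innerSL ℂ (hmem.toLp _))
  refine (hc z hz).unique (h1.congr_fun fun n => ?_)
  rw [innerSL_apply_apply, inner_smul_right, hP, poissonInt_congr (coeFn_monomialL2 n),
    poissonInt_ei_pow n hz]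

theorem HasBoundaryValues.ae_eq {f : ℂ → ℂ} {F G : UnitCirc → ℂ} (hF : HasBoundaryValues f F)
    (hG : HasBoundaryValues f G) : F =ᵐ[lam] G := by
  filter_upwards [hF, hG] with θ h1 h2 using tendsto_nhds_unique h1 h2

theorem HasBoundaryValues.ae_eq_boundaryValue {f : ℂ → ℂ} {F : UnitCirc → ℂ}
    (hF : HasBoundaryValues f F) : boundaryValue f =ᵐ[lam] F := by
  filter_upwards [hF] with θ h1 using h1.limUnder_eq

theorem HasBoundaryValues.congr {f : ℂ → ℂ} {F G : UnitCirc → ℂ} (hF : HasBoundaryValues f F)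
    (h : F =ᵐ[lam] G) : HasBoundaryValues f G := by
  filter_upwards [hF, h] with θ h1 h2 using h2 ▸ h1

theorem HasBoundaryValues.mul {f g : ℂ → ℂ} {F G : UnitCirc → ℂ} (hF : HasBoundaryValues f F)
    (hG : HasBoundaryValues g G) : HasBoundaryValues (fun z => f z * g z) fun θ => F θ * G θ := by
  filter_upwards [hF, hG] with θ h1 h2 using h1.mul h2

theorem HasBoundaryValues.of_poissonInt {f : ℂ → ℂ} {F : UnitCirc → ℂ} (hF : Integrable F lam)
    (h : ∀ z : ℂ, ‖z‖ < 1 → f z = poissonInt F z) : HasBoundaryValues f F := by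
  filter_upwards [ae_tendsto_poissonInt hF] with θ hθ
  refine hθ.congr' ?_
  filter_upwards [Ioo_mem_nhdsLT (zero_lt_one' ℝ)] with r hr
  exact (h _ (norm_mul_ei_lt hr.1.le hr.2 θ)).symm

/-- The Poisson representation of a bounded holomorphic function with boundary function `F`. -/
theorem eq_poissonInt_of_bounded {h : ℂ → ℂ} (hd : DifferentiableOn ℂ h (Metric.ball 0 1))
    {M : ℝ} (hM : ∀ z : ℂ, ‖z‖ < 1 → ‖h z‖ ≤ M) {F : UnitCirc → ℂ} (hF : HasBoundaryValues h F) :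
    Integrable F lam ∧ ∀ z : ℂ, ‖z‖ < 1 → h z = poissonInt F z := by
  obtain ⟨H, hH, hp⟩ := exists_eq_poissonInt_of_bounded hd hM
  have := hF.ae_eq (.of_poissonInt hH hp)
  exact ⟨hH.congr this.symm, fun z hz => (hp z hz).trans (poissonInt_congr this.symm z)⟩

theorem exists_hasBoundaryValues_of_bounded {h : ℂ → ℂ}
    (hd : DifferentiableOn ℂ h (Metric.ball 0 1)) {M : ℝ} (hM : ∀ z : ℂ, ‖z‖ < 1 → ‖h z‖ ≤ M) :
    ∃ H, Integrable H lam ∧ HasBoundaryValues h H := by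
  obtain ⟨H, hH, hp⟩ := exists_eq_poissonInt_of_bounded hd hM
  exact ⟨H, hH, .of_poissonInt hH hp⟩

/-- The outer function `exp (-∫ (e^{iθ} + z) / (e^{iθ} - z) v dλ)`, of modulus `e^{-P[v]}`. -/
noncomputable def outerNeg (v : UnitCirc → ℝ) (z : ℂ) : ℂ := Complex.exp (-herglotzInt v z)

section Outer

variable {v : UnitCirc → ℝ} (hv : Integrable v lam)
include hv

theorem differentiableOn_outerNeg : DifferentiableOn ℂ (outerNeg v) (Metric.ball 0 1) :=
  (differentiableOn_herglotzInt hv).neg.cexp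

theorem norm_outerNeg {z : ℂ} (hz : ‖z‖ < 1) : ‖outerNeg v z‖ = exp (-poissonInt v z) := by
  rw [outerNeg, Complex.norm_exp, Complex.neg_re, re_herglotzInt hv hz]

theorem norm_outerNeg_le {m : ℝ} (hm : ∀ᵐ θ ∂lam, m ≤ v θ) {z : ℂ} (hz : ‖z‖ < 1) :
    ‖outerNeg v z‖ ≤ exp (-m) := by
  rw [norm_outerNeg hv hz, exp_le_exp, neg_le_neg_iff]
  have := poissonInt_mono (integrable_const m) hv hm hz
  rwa [poissonInt_const m hz] at this

/-- If `v` is bounded below, the outer function of modulus `e^{-P[v]}` is bounded, so that it has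
radial limits; by Fatou's theorem for `v`, these have modulus `e^{-v}`. -/
theorem exists_hasBoundaryValues_outerNeg {m : ℝ} (hm : ∀ᵐ θ ∂lam, m ≤ v θ) :
    ∃ B : UnitCirc → ℂ, Integrable B lam ∧ HasBoundaryValues (outerNeg v) B ∧
      ∀ᵐ θ ∂lam, ‖B θ‖ = exp (-v θ) := by
  obtain ⟨B, hBi, hB⟩ := exists_hasBoundaryValues_of_bounded (differentiableOn_outerNeg hv)
    (fun z hz => norm_outerNeg_le hv hm hz)
  refine ⟨B, hBi, hB, ?_⟩
  filter_upwards [hB, ae_tendsto_poissonInt hv] with θ h1 h2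
  refine tendsto_nhds_unique h1.norm ((Real.continuous_exp.tendsto _).comp h2.neg |>.congr' ?_)
  filter_upwards [Ioo_mem_nhdsLT (zero_lt_one' ℝ)] with r hr
  exact (norm_outerNeg hv (norm_mul_ei_lt hr.1.le hr.2 θ)).symm

end Outer

/-! ### Smirnov functions and the Poisson representation -/

/-- A dominated convergence theorem with varying majorants: if `0 ≤ f_i ≤ g_i`, both families
converge almost everywhere, and `∫ g_i` converges to `∫ g`, then `∫ f_i` converges to `∫ f`. -/
theorem tendsto_integral_of_le_of_tendsto_integral {Ω ι : Type*} [MeasurableSpace Ω]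
    {μ : Measure Ω} {l : Filter ι} [l.IsCountablyGenerated] [l.NeBot] {f g : ι → Ω → ℝ}
    {f₀ g₀ : Ω → ℝ} (hf : ∀ᶠ i in l, Integrable (f i) μ) (hg : ∀ᶠ i in l, Integrable (g i) μ)
    (hg₀ : Integrable g₀ μ) (hnn : ∀ i x, 0 ≤ f i x)
    (hfg : ∀ᶠ i in l, ∀ x, f i x ≤ g i x)
    (hflim : ∀ᵐ x ∂μ, Tendsto (fun i => f i x) l (𝓝 (f₀ x)))
    (hglim : ∀ᵐ x ∂μ, Tendsto (fun i => g i x) l (𝓝 (g₀ x)))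
    (hint : Tendsto (fun i => ∫ x, g i x ∂μ) l (𝓝 (∫ x, g₀ x ∂μ))) :
    Tendsto (fun i => ∫ x, f i x ∂μ) l (𝓝 (∫ x, f₀ x ∂μ)) := by
  have hg₀nn : ∀ᵐ x ∂μ, 0 ≤ g₀ x := by
    filter_upwards [hglim] with x hx
    refine ge_of_tendsto hx ?_
    filter_upwards [hfg] with i hi using (hnn i x).trans (hi x)
  have hle : ∀ᵐ x ∂μ, f₀ x ≤ g₀ x := by
    filter_upwards [hflim, hglim] with x hx hx'
    refine le_of_tendsto_of_tendsto hx hx' ?_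
    filter_upwards [hfg] with i hi using hi x
  have hcut : ∀ {k : ι → Ω → ℝ} {k₀ : Ω → ℝ}, (∀ᶠ i in l, Integrable (k i) μ) →
      (∀ᶠ i in l, ∀ x, 0 ≤ k i x) → (∀ᵐ x ∂μ, Tendsto (fun i => k i x) l (𝓝 (k₀ x))) →
      Tendsto (fun i => ∫ x, min (k i x) (g₀ x) ∂μ) l (𝓝 (∫ x, min (k₀ x) (g₀ x) ∂μ)) := by
    intro k k₀ hk hk0 hklim
    refine tendsto_integral_filter_of_dominated_convergence g₀ ?_ ?_ hg₀ ?_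
    · filter_upwards [hk] with i hi using (hi.inf hg₀).aestronglyMeasurable
    · filter_upwards [hk0] with i hi
      filter_upwards [hg₀nn] with x hx
      rw [Real.norm_of_nonneg (le_min (hi x) hx)]
      exact min_le_right _ _
    · filter_upwards [hklim] with x hx using hx.min tendsto_const_nhds
  have h1 := hcut hf (Eventually.of_forall hnn) hflim
  have h2 := hcut hg (hfg.mono fun i hi x => (hnn i x).trans (hi x)) hglim
  have e1 : ∫ x, min (f₀ x) (g₀ x) ∂μ = ∫ x, f₀ x ∂μ :=
    integral_congr_ae (hle.mono fun x hx => min_eq_left hx)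
  have e2 : ∫ x, min (g₀ x) (g₀ x) ∂μ = ∫ x, g₀ x ∂μ := by simp
  rw [e1] at h1
  rw [e2] at h2
  have h3 : Tendsto (fun i => ∫ x, (g i x - min (g i x) (g₀ x)) ∂μ) l (𝓝 0) := by
    have := hint.sub h2
    rw [sub_self] at this
    refine this.congr' ?_
    filter_upwards [hg] with i hi using (integral_sub hi (hi.inf hg₀)).symm
  have h4 : Tendsto (fun i => ∫ x, (f i x - min (f i x) (g₀ x)) ∂μ) l (𝓝 0) := by
    refine tendsto_of_tendsto_of_tendsto_of_le_of_le' tendsto_const_nhds h3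
      (Eventually.of_forall fun i => integral_nonneg fun x => sub_nonneg.2 (min_le_left _ _)) ?_
    filter_upwards [hf, hg, hfg] with i hi hi' hle
    refine integral_mono (hi.sub (hi.inf hg₀)) (hi'.sub (hi'.inf hg₀)) fun x => ?_
    have := hle x
    simp only
    rcases le_total (f i x) (g₀ x) with h | h
    · rw [min_eq_left h, sub_self]
      exact sub_nonneg.2 (min_le_left _ _)
    · rw [min_eq_right h, min_eq_right (h.trans this)]
      linarith
  have h5 := h4.add h1
  rw [zero_add] at h5
  refine h5.congr' ?_
  filter_upwards [hf] with i hi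
  refine (integral_add (hi.sub (hi.inf hg₀)) (hi.inf hg₀)).symm.trans ?_
  simp

theorem integrable_prod_pk {u : UnitCirc → ℝ} (hu : Integrable u lam) {r : ℝ} (h0 : 0 ≤ r)
    (h1 : r < 1) : Integrable (fun x : UnitCirc × UnitCirc => pk (r * ei x.1) x.2 * u x.2)
      (lam.prod lam) := by
  refine (hu.comp_snd lam).bdd_mul (c := 2 / (1 - r)) ?_ (ae_of_all _ fun x => ?_)
  · refine Continuous.aestronglyMeasurable ?_
    simp only [pk_eq]
    have := continuous_ei
    refine Continuous.div (by fun_prop) (by fun_prop) fun x => ?_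
    exact pow_ne_zero _ (norm_ne_zero_iff.2 (ei_sub_ne_zero (norm_mul_ei_lt h0 h1 x.1) x.2))
  · refine (norm_pk_le (norm_mul_ei_lt h0 h1 x.1) x.2).trans_eq ?_
    rw [norm_mul, norm_ei, mul_one, Complex.norm_real, Real.norm_of_nonneg h0]

theorem integrable_poissonInt_circle {u : UnitCirc → ℝ} (hu : Integrable u lam) {r : ℝ}
    (h0 : 0 ≤ r) (h1 : r < 1) : Integrable (fun θ => poissonInt u (r * ei θ)) lam :=
  (integrable_prod_pk hu h0 h1).integral_prod_left

/-- The mean of a Poisson integral over each circle is the mean of its boundary function. -/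
theorem integral_poissonInt_circle {u : UnitCirc → ℝ} (hu : Integrable u lam) {r : ℝ}
    (h0 : 0 ≤ r) (h1 : r < 1) : ∫ θ, poissonInt u (r * ei θ) ∂lam = ∫ θ, u θ ∂lam := by
  simp only [poissonInt, smul_eq_mul]
  rw [integral_integral_swap (integrable_prod_pk hu h0 h1)]
  refine integral_congr_ae (ae_of_all _ fun η => ?_)
  simp only [integral_mul_const, pk_symm r _ η]
  rw [integral_pk (norm_mul_ei_lt h0 h1 η), one_mul]

theorem continuous_circle {f : ℂ → ℂ} (hf : DifferentiableOn ℂ f (Metric.ball 0 1)) {r : ℝ}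
    (h0 : 0 ≤ r) (h1 : r < 1) : Continuous fun θ => f (r * ei θ) :=
  hf.continuousOn.comp_continuous (continuous_const.mul continuous_ei) fun θ => by
    simpa using norm_mul_ei_lt h0 h1 θ

theorem integrable_posLog_circle {f : ℂ → ℂ} (hf : DifferentiableOn ℂ f (Metric.ball 0 1)) {r : ℝ}
    (h0 : 0 ≤ r) (h1 : r < 1) : Integrable (fun θ => posLog ‖f (r * ei θ)‖) lam :=
  (continuous_posLog.comp (continuous_circle hf h0 h1).norm).integrable_of_hasCompactSupport
    (HasCompactSupport.of_compactSpace _)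

theorem posLog_le_self {x : ℝ} (hx : 0 ≤ x) : posLog x ≤ x :=
  max_le hx (Real.log_le_self hx)

theorem le_exp_posLog {x : ℝ} (hx : 0 ≤ x) : x ≤ exp (posLog x) := by
  rcases hx.eq_or_lt with rfl | h
  · exact (exp_pos _).le
  · rw [← Real.log_le_iff_le_exp h]
    exact le_max_right _ _

/-- A holomorphic function that is the Poisson integral of an integrable function, that is a
function of the Hardy space `H¹`, belongs to the Smirnov class. -/
theorem isSmirnov_of_poissonInt {f : ℂ → ℂ} (hd : DifferentiableOn ℂ f (Metric.ball 0 1))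
    {F : UnitCirc → ℂ} (hF : Integrable F lam) (hp : ∀ z : ℂ, ‖z‖ < 1 → f z = poissonInt F z) :
    IsSmirnov f := by
  have hb : HasBoundaryValues f F := .of_poissonInt hF hp
  have hle : ∀ r : ℝ, 0 ≤ r → r < 1 → ∀ θ, posLog ‖f (r * ei θ)‖ ≤
      poissonInt (fun η => ‖F η‖) (r * ei θ) := by
    intro r h0 h1 θ
    have hz := norm_mul_ei_lt h0 h1 θ
    refine (posLog_le_self (norm_nonneg _)).trans ?_
    rw [hp _ hz]
    exact norm_poissonInt_le F hz
  refine ⟨⟨hd, ∫ θ, ‖F θ‖ ∂lam, fun r hr => ?_⟩, ?_⟩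
  · rw [← integral_poissonInt_circle hF.norm hr.1 hr.2]
    exact integral_mono (integrable_posLog_circle hd hr.1 hr.2)
      (integrable_poissonInt_circle hF.norm hr.1 hr.2) (hle r hr.1 hr.2)
  · have hev : ∀ᶠ r : ℝ in 𝓝[<] 1, 0 ≤ r ∧ r < 1 := by
      filter_upwards [Ioo_mem_nhdsLT (zero_lt_one' ℝ)] with r hr using ⟨hr.1.le, hr.2⟩
    refine tendsto_integral_of_le_of_tendsto_integral
      (f := fun (r : ℝ) θ => posLog ‖f (r * ei θ)‖)
      (g := fun (r : ℝ) θ => poissonInt (fun η => ‖F η‖) (r * ei θ)) (g₀ := fun η => ‖F η‖)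
      ?_ ?_ hF.norm (fun _ _ => posLog_nonneg) ?_ ?_ (ae_tendsto_poissonInt hF.norm) ?_
    · filter_upwards [hev] with r hr using integrable_posLog_circle hd hr.1 hr.2
    · filter_upwards [hev] with r hr using integrable_poissonInt_circle hF.norm hr.1 hr.2
    · filter_upwards [hev] with r hr using hle r hr.1 hr.2
    · filter_upwards [hb, hb.ae_eq_boundaryValue] with θ h1 h2
      rw [h2]
      exact (continuous_posLog.tendsto _).comp h1.norm
    · refine tendsto_const_nhds.congr' ?_
      filter_upwards [hev] with r hr using (integral_poissonInt_circle hF.norm hr.1 hr.2).symm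

/-- The maximum principle for bounded holomorphic functions and their radial limits. -/
theorem norm_le_one_of_boundary {h : ℂ → ℂ} (hd : DifferentiableOn ℂ h (Metric.ball 0 1))
    {M : ℝ} (hM : ∀ z : ℂ, ‖z‖ < 1 → ‖h z‖ ≤ M) {F : UnitCirc → ℂ} (hF : HasBoundaryValues h F)
    (hF1 : ∀ᵐ θ ∂lam, ‖F θ‖ ≤ 1) {z : ℂ} (hz : ‖z‖ < 1) : ‖h z‖ ≤ 1 := by
  obtain ⟨hi, hp⟩ := eq_poissonInt_of_bounded hd hM hF
  rw [hp z hz]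
  refine (norm_poissonInt_le F hz).trans ?_
  refine (poissonInt_mono hi.norm (integrable_const 1) hF1 hz).trans_eq ?_
  exact poissonInt_const 1 hz

/-- `log⁺ |f(rz)|` is at most the Poisson integral of `log⁺ |f(r e^{iθ})|`. Multiplying `f(rz)` by
the outer function whose modulus on the circle is `exp (-log⁺ |f(r e^{iθ})|)` produces a bounded
function of modulus at most `1` on the circle. -/
theorem norm_le_exp_poissonInt_circle {f : ℂ → ℂ} (hd : DifferentiableOn ℂ f (Metric.ball 0 1))
    {r : ℝ} (h0 : 0 ≤ r) (h1 : r < 1) {z : ℂ} (hz : ‖z‖ < 1) :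
    ‖f (r * z)‖ ≤ exp (poissonInt (fun θ => posLog ‖f (r * ei θ)‖) z) := by
  set v : UnitCirc → ℝ := fun θ => posLog ‖f (r * ei θ)‖ with hv
  have hvi : Integrable v lam := integrable_posLog_circle hd h0 h1
  have hv0 : ∀ᵐ θ ∂lam, 0 ≤ v θ := ae_of_all _ fun θ => posLog_nonneg
  obtain ⟨B, hBi, hB, hBn⟩ := exists_hasBoundaryValues_outerNeg hvi hv0
  have hsub : ∀ w : ℂ, ‖w‖ ≤ 1 → (r : ℂ) * w ∈ Metric.closedBall (0 : ℂ) r := by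
    intro w hw
    rw [mem_closedBall_zero_iff, norm_mul, Complex.norm_real, Real.norm_of_nonneg h0]
    exact mul_le_of_le_one_right h0 hw
  have hrb : Metric.closedBall (0 : ℂ) r ⊆ Metric.ball 0 1 := Metric.closedBall_subset_ball h1
  obtain ⟨M, hM⟩ := (isCompact_closedBall (0 : ℂ) r).exists_bound_of_continuousOn
    (hd.continuousOn.mono hrb)
  have hM0 : 0 ≤ M := (norm_nonneg _).trans (hM 0 (by simpa using h0))
  have hfr : DifferentiableOn ℂ (fun w : ℂ => f (r * w)) (Metric.ball 0 1) := by
    refine hd.comp (by fun_prop) fun w hw => hrb (hsub w ?_)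
    simpa using (mem_ball_zero_iff.1 hw).le
  have hfb : HasBoundaryValues (fun w : ℂ => f (r * w)) fun θ => f (r * ei θ) := by
    refine ae_of_all _ fun θ => ?_
    have hc : ContinuousAt (fun s : ℝ => f (r * (s * ei θ))) 1 := by
      have : ContinuousAt f (r * (((1 : ℝ) : ℂ) * ei θ)) := by
        refine hd.continuousOn.continuousAt (Metric.isOpen_ball.mem_nhds ?_)
        simpa using norm_mul_ei_lt h0 h1 θ
      exact ContinuousAt.comp (f := fun s : ℝ => (r : ℂ) * (s * ei θ)) this
        (Continuous.continuousAt (by fun_prop))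
    simpa using hc.tendsto.mono_left nhdsWithin_le_nhds
  have key := norm_le_one_of_boundary (hfr.mul (differentiableOn_outerNeg hvi)) (M := M * 1)
    (fun w hw => ?_) (hfb.mul hB) ?_ hz
  · simp only [Pi.mul_apply, norm_mul] at key
    rw [norm_outerNeg hvi hz, exp_neg, ← div_eq_mul_inv, div_le_one (exp_pos _)] at key
    exact key
  · simp only [Pi.mul_apply, norm_mul]
    gcongr
    · exact hM _ (hsub w hw.le)
    · simpa using norm_outerNeg_le hvi hv0 hw
  · filter_upwards [hBn] with θ hθ
    rw [norm_mul, hθ, exp_neg, ← div_eq_mul_inv, div_le_one (exp_pos _)]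
    exact le_exp_posLog (norm_nonneg _)

/-- The convergence of the means of `log⁺ |f|` to that of the boundary function makes `log⁺ |f|`
at most the Poisson integral of its boundary values: the bound on smaller circles passes to the
limit. -/
theorem IsSmirnov.norm_le_exp_poissonInt {f : ℂ → ℂ} (hf : IsSmirnov f) {F : UnitCirc → ℂ}
    (hF : HasBoundaryValues f F) : Integrable (fun θ => posLog ‖F θ‖) lam ∧
      ∀ z : ℂ, ‖z‖ < 1 → ‖f z‖ ≤ exp (poissonInt (fun θ => posLog ‖F θ‖) z) := by
  obtain ⟨⟨hd, C, hC⟩, hlim⟩ := hf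
  have hev : ∀ᶠ r : ℝ in 𝓝[<] 1, 0 ≤ r ∧ r < 1 := by
    filter_upwards [Ioo_mem_nhdsLT (zero_lt_one' ℝ)] with r hr using ⟨hr.1.le, hr.2⟩
  have hae : ∀ᵐ θ ∂lam, Tendsto (fun r : ℝ => posLog ‖f (r * ei θ)‖) (𝓝[<] 1)
      (𝓝 (posLog ‖F θ‖)) := by
    filter_upwards [hF] with θ h1 using (continuous_posLog.tendsto _).comp h1.norm
  have hint : Integrable (fun θ => posLog ‖F θ‖) lam := by
    set ρ : ℕ → ℝ := fun n => 1 - 1 / (n + 1) with hρ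
    have hρ01 : ∀ n, 0 ≤ ρ n ∧ ρ n < 1 := by
      intro n
      have h1 : (1 : ℝ) / (n + 1) ≤ 1 := by
        rw [div_le_one (by positivity)]
        linarith [(Nat.cast_nonneg n : (0 : ℝ) ≤ n)]
      have h2 : (0 : ℝ) < 1 / (n + 1) := by positivity
      exact ⟨by simp only [hρ]; linarith, by simp only [hρ]; linarith⟩
    have hρt : Tendsto ρ atTop (𝓝[<] 1) := by
      refine tendsto_nhdsWithin_iff.2 ⟨?_, Eventually.of_forall fun n => (hρ01 n).2⟩
      simpa [hρ] using (tendsto_one_div_add_atTop_nhds_zero_nat (𝕜 := ℝ)).const_sub 1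
    have haeρ : ∀ᵐ θ ∂lam, Tendsto (fun n => posLog ‖f (ρ n * ei θ)‖) atTop
        (𝓝 (posLog ‖F θ‖)) := by
      filter_upwards [hae] with θ hθ using hθ.comp hρt
    have hi : ∀ n, Integrable (fun θ => posLog ‖f (ρ n * ei θ)‖) lam := fun n =>
      integrable_posLog_circle hd (hρ01 n).1 (hρ01 n).2
    refine memLp_one_iff_integrable.1 ⟨aestronglyMeasurable_of_tendsto_ae atTop
      (fun n => (hi n).aestronglyMeasurable) haeρ, ?_⟩
    refine (Lp.eLpNorm_lim_le_liminf_eLpNorm (p := 1) (fun n => (hi n).aestronglyMeasurable) _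
      haeρ).trans_lt ?_
    refine lt_of_le_of_lt ?_ (ENNReal.ofReal_lt_top (r := C))
    refine liminf_le_of_frequently_le' (Frequently.of_forall fun n => ?_)
    rw [eLpNorm_one_eq_lintegral_enorm, ← ofReal_integral_norm_eq_lintegral_enorm (hi n)]
    refine ENNReal.ofReal_le_ofReal ?_
    simp only [Real.norm_of_nonneg posLog_nonneg]
    exact hC _ (hρ01 n)
  refine ⟨hint, fun z hz => ?_⟩
  have hlim' : Tendsto (fun r : ℝ => ∫ θ, posLog ‖f (r * ei θ)‖ ∂lam) (𝓝[<] 1)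
      (𝓝 (∫ θ, posLog ‖F θ‖ ∂lam)) := by
    convert hlim using 2
    refine integral_congr_ae ?_
    filter_upwards [hF.ae_eq_boundaryValue] with θ hθ
    simp only [hθ]
  have h1 : Tendsto (fun r : ℝ => poissonInt (fun θ => posLog ‖f (r * ei θ)‖) z) (𝓝[<] 1)
      (𝓝 (poissonInt (fun θ => posLog ‖F θ‖) z)) := by
    refine tendsto_integral_of_le_of_tendsto_integral
      (g := fun (r : ℝ) θ => 2 / (1 - ‖z‖) * posLog ‖f (r * ei θ)‖)
      (g₀ := fun θ => 2 / (1 - ‖z‖) * posLog ‖F θ‖)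
      ?_ ?_ (hint.const_mul _) ?_ ?_ ?_ ?_ ?_
    · filter_upwards [hev] with r hr
      exact integrable_pk_smul (integrable_posLog_circle hd hr.1 hr.2) hz
    · filter_upwards [hev] with r hr
      exact (integrable_posLog_circle hd hr.1 hr.2).const_mul _
    · exact fun r θ => mul_nonneg (pk_pos hz θ).le posLog_nonneg
    · refine Eventually.of_forall fun r θ => ?_
      exact mul_le_mul_of_nonneg_right ((le_abs_self _).trans (norm_pk_le hz θ)) posLog_nonneg
    · filter_upwards [hae] with θ hθ using hθ.const_mul _
    · filter_upwards [hae] with θ hθ using hθ.const_mul _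
    · simp only [integral_const_mul]
      exact hlim'.const_mul _
  have h2 : Tendsto (fun r : ℝ => ‖f (r * z)‖) (𝓝[<] 1) (𝓝 ‖f z‖) := by
    have hc : ContinuousAt (fun s : ℝ => f (s * z)) 1 := by
      have : ContinuousAt f (((1 : ℝ) : ℂ) * z) := by
        refine hd.continuousOn.continuousAt (Metric.isOpen_ball.mem_nhds ?_)
        simpa using hz
      exact ContinuousAt.comp (f := fun s : ℝ => (s : ℂ) * z) this
        (Continuous.continuousAt (by fun_prop))
    simpa using (hc.tendsto.mono_left nhdsWithin_le_nhds).norm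
  refine le_of_tendsto_of_tendsto h2 ((Real.continuous_exp.tendsto _).comp h1) ?_
  filter_upwards [hev] with r hr using norm_le_exp_poissonInt_circle hd hr.1 hr.2 hz

/-- A holomorphic function with integrable boundary values that has a harmonic majorant
`log |f| ≤ P[u]`, with `u` integrable, is the Poisson integral of its boundary function. The outer
functions `b_n` of modulus `e^{-(u - n)⁺}` make `f b_n` bounded, and their boundary functions
converge to `1` in `L²` because `b_n(0) → 1`. -/
theorem eq_poissonInt_of_majorant {f : ℂ → ℂ} (hd : DifferentiableOn ℂ f (Metric.ball 0 1))
    {u : UnitCirc → ℝ} (hu : Integrable u lam)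
    (hfu : ∀ z : ℂ, ‖z‖ < 1 → ‖f z‖ ≤ exp (poissonInt u z))
    {F : UnitCirc → ℂ} (hF : HasBoundaryValues f F) (hFi : Integrable F lam) {z : ℂ}
    (hz : ‖z‖ < 1) : f z = poissonInt F z := by
  set v : ℕ → UnitCirc → ℝ := fun n θ => max (u θ - n) 0 with hv
  have hvi : ∀ n, Integrable (v n) lam := fun n =>
    (hu.sub (integrable_const (n : ℝ))).sup (integrable_const 0)
  have hv0 : ∀ n, ∀ᵐ θ ∂lam, 0 ≤ v n θ := fun n => ae_of_all _ fun θ => le_max_right _ _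
  have hvt : ∀ θ, Tendsto (fun n => v n θ) atTop (𝓝 0) := by
    intro θ
    obtain ⟨N, hN⟩ := exists_nat_ge (u θ)
    refine tendsto_const_nhds.congr' ?_
    filter_upwards [eventually_ge_atTop N] with n hn
    have : (N : ℝ) ≤ n := by exact_mod_cast hn
    exact (max_eq_right (by linarith)).symm
  have hvle : ∀ n θ, |v n θ| ≤ |u θ| := by
    intro n θ
    rw [abs_of_nonneg (le_max_right _ _)]
    refine max_le ?_ (abs_nonneg _)
    linarith [le_abs_self (u θ), (Nat.cast_nonneg n : (0 : ℝ) ≤ n)]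
  choose B hBi hB hBn using fun n => exists_hasBoundaryValues_outerNeg (hvi n) (hv0 n)
  have hB1 : ∀ n, ∀ᵐ θ ∂lam, ‖B n θ‖ ≤ 1 := by
    intro n
    filter_upwards [hBn n] with θ hθ
    rw [hθ, exp_le_one_iff, neg_nonpos]
    exact le_max_right _ _
  have hout : ∀ w : ℂ, ‖w‖ < 1 → Tendsto (fun n => outerNeg (v n) w) atTop (𝓝 1) := by
    intro w hw
    have h1 : Tendsto (fun n => herglotzInt (v n) w) atTop (𝓝 (∫ _, (0 : ℂ) ∂lam)) := by
      refine tendsto_integral_filter_of_dominated_convergence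
        (fun θ => 2 / (1 - ‖w‖) * |u θ|) ?_ ?_ (hu.abs.const_mul _) ?_
      · exact Eventually.of_forall fun n =>
          (integrable_herglotz_mul (hvi n).ofReal hw).aestronglyMeasurable
      · refine Eventually.of_forall fun n => ae_of_all _ fun θ => ?_
        rw [norm_mul, Complex.norm_real]
        have := norm_herglotz_le hw θ
        gcongr
        exact hvle n θ
      · refine ae_of_all _ fun θ => ?_
        have := (Complex.continuous_ofReal.tendsto 0).comp (hvt θ)
        simpa using this.const_mul (herglotzRieszKernel 0 w (ei θ))
    rw [integral_zero] at h1
    have := (Complex.continuous_exp.tendsto _).comp h1.neg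
    simpa [Function.comp_def, outerNeg] using this
  -- each product `f b_n` is bounded, hence the Poisson integral of its boundary function
  have hprod : ∀ n, ∀ w : ℂ, ‖w‖ < 1 →
      f w * outerNeg (v n) w = poissonInt (fun θ => F θ * B n θ) w := by
    intro n
    refine (eq_poissonInt_of_bounded (hd.mul (differentiableOn_outerNeg (hvi n)))
      (M := exp n) (fun w hw => ?_) (hF.mul (hB n))).2
    simp only [Pi.mul_apply, norm_mul]
    rw [norm_outerNeg (hvi n) hw]
    calc ‖f w‖ * exp (-poissonInt (v n) w)
        ≤ exp (poissonInt u w) * exp (-poissonInt (v n) w) := by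
          gcongr
          exact hfu w hw
      _ = exp (poissonInt (fun θ => u θ - v n θ) w) := by
          rw [← exp_add, poissonInt_sub hu (hvi n) hw, sub_eq_add_neg]
      _ ≤ exp n := by
          rw [exp_le_exp]
          refine (poissonInt_mono (hu.sub (hvi n)) (integrable_const (n : ℝ))
            (ae_of_all _ fun θ => ?_) hw).trans_eq (poissonInt_const (n : ℝ) hw)
          have := le_max_left (u θ - n) 0
          simp only [Pi.sub_apply, hv]
          linarith
  have hB0 : ∀ n, ∫ θ, B n θ ∂lam = outerNeg (v n) 0 := by
    intro n
    have := (eq_poissonInt_of_bounded (differentiableOn_outerNeg (hvi n))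
      (fun w hw => norm_outerNeg_le (hvi n) (hv0 n) hw) (hB n)).2 0 (by simp)
    rw [this, poissonInt_zero]
  have hsqi : ∀ n, Integrable (fun θ => ‖B n θ - 1‖ ^ 2) lam := by
    intro n
    refine (integrable_const (4 : ℝ)).mono'
      ((((hBi n).sub (integrable_const 1)).norm.aestronglyMeasurable).pow 2) ?_
    filter_upwards [hB1 n] with θ hθ
    rw [Real.norm_of_nonneg (by positivity)]
    have := norm_sub_le (B n θ) 1
    rw [norm_one] at this
    nlinarith [norm_nonneg (B n θ - 1)]
  have hsq : Tendsto (fun n => ∫ θ, ‖B n θ - 1‖ ^ 2 ∂lam) atTop (𝓝 0) := by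
    have h1 : Tendsto (fun n => 2 - 2 * (outerNeg (v n) 0).re) atTop (𝓝 (2 - 2 * (1 : ℂ).re)) :=
      (((Complex.continuous_re.tendsto _).comp (hout 0 (by simp))).const_mul 2).const_sub 2
    rw [Complex.one_re, mul_one, sub_self] at h1
    refine squeeze_zero (fun n => integral_nonneg fun θ => by positivity) (fun n => ?_) h1
    have hrei : Integrable (fun θ => 2 * (B n θ).re) lam := (hBi n).re.const_mul 2
    have hre : ∫ θ, (B n θ).re ∂lam = (outerNeg (v n) 0).re := by
      rw [← hB0 n]
      exact Complex.reCLM.integral_comp_comm (hBi n)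
    have h2 : ∫ θ, (2 - 2 * (B n θ).re) ∂lam = 2 - 2 * (outerNeg (v n) 0).re := by
      rw [integral_sub (integrable_const _) hrei, integral_const_mul, hre]
      simp
    rw [← h2]
    refine integral_mono_ae (hsqi n) ((integrable_const _).sub hrei) ?_
    filter_upwards [hB1 n] with θ hθ
    have h3 : ‖B n θ - 1‖ ^ 2 = ‖B n θ‖ ^ 2 - 2 * (B n θ).re + 1 := by
      rw [Complex.sq_norm, Complex.sq_norm, Complex.normSq_apply, Complex.normSq_apply]
      simp only [Complex.sub_re, Complex.one_re, Complex.sub_im, Complex.one_im]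
      ring
    simp only [h3]
    have : ‖B n θ‖ ^ 2 ≤ 1 := pow_le_one₀ (norm_nonneg _) hθ
    change _ ≤ 2 - 2 * (B n θ).re
    linarith
  obtain ⟨ns, hns, hae⟩ : ∃ ns : ℕ → ℕ, StrictMono ns ∧
      ∀ᵐ θ ∂lam, Tendsto (fun i => ‖B (ns i) θ - 1‖ ^ 2) atTop (𝓝 0) := by
    refine TendstoInMeasure.exists_seq_tendsto_ae (g := fun _ => (0 : ℝ))
      (f := fun n θ => ‖B n θ - 1‖ ^ 2) ?_
    refine tendstoInMeasure_of_tendsto_eLpNorm (p := 1) one_ne_zero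
      (fun n => (hsqi n).aestronglyMeasurable) aestronglyMeasurable_const ?_
    have h1 := (ENNReal.continuous_ofReal.tendsto 0).comp hsq
    rw [ENNReal.ofReal_zero] at h1
    refine h1.congr fun n => ?_
    have e : (fun θ => ‖B n θ - 1‖ ^ 2) - (fun _ => (0 : ℝ)) = fun θ => ‖B n θ - 1‖ ^ 2 := by
      ext θ; simp
    rw [e, eLpNorm_one_eq_lintegral_enorm, ← ofReal_integral_norm_eq_lintegral_enorm (hsqi n)]
    simp
  have hlim1 : Tendsto (fun i => poissonInt (fun θ => F θ * B (ns i) θ) z) atTop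
      (𝓝 (poissonInt F z)) := by
    refine tendsto_integral_filter_of_dominated_convergence
      (fun θ => 2 / (1 - ‖z‖) * ‖F θ‖) ?_ ?_ (hFi.norm.const_mul _) ?_
    · refine Eventually.of_forall fun i => ?_
      exact (continuous_pk hz).aestronglyMeasurable.smul
        (hFi.aestronglyMeasurable.mul (hBi _).aestronglyMeasurable)
    · refine Eventually.of_forall fun i => ?_
      filter_upwards [hB1 (ns i)] with θ hθ
      rw [norm_smul, norm_mul]
      have := norm_pk_le hz θ
      gcongr
      exact mul_le_of_le_one_right (norm_nonneg _) hθ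
    · filter_upwards [hae] with θ hθ
      have h1 : Tendsto (fun i => B (ns i) θ) atTop (𝓝 1) := by
        rw [tendsto_iff_norm_sub_tendsto_zero]
        have := (Real.continuous_sqrt.tendsto 0).comp hθ
        simpa [Function.comp_def, Real.sqrt_sq (norm_nonneg _)] using this
      simpa using (h1.const_mul (F θ)).const_smul (pk z θ)
  have hlim2 : Tendsto (fun i => f z * outerNeg (v (ns i)) z) atTop (𝓝 (f z)) := by
    simpa using ((hout z hz).comp hns.tendsto_atTop).const_mul (f z)
  refine tendsto_nhds_unique hlim2 (hlim1.congr fun i => (hprod _ z hz).symm)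

/-! ### Functionals on `L^p` -/

section Dual

variable {X : Type*} [MeasurableSpace X] {μ : Measure X} [IsFiniteMeasure μ] {p : ENNReal}
  [Fact (1 ≤ p)]

open Classical in
/-- The signed measure `A ↦ L(1_A)` of a continuous real functional on `L^p`, `p < ∞`. -/
noncomputable def functionalMeasure (hp : p ≠ ⊤) (L : Lp ℂ p μ →L[ℝ] ℝ) : SignedMeasure X where
  measureOf' A := if hA : MeasurableSet A then
    L (indicatorConstLp p hA (measure_ne_top μ A) 1) else 0
  empty' := by simp
  not_measurable' A hA := by simp [hA]
  m_iUnion' f hf hd := by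
    have hs : ∀ s : Finset ℕ, MeasurableSet (⋃ i ∈ s, f i) := fun s =>
      s.measurableSet_biUnion fun i _ => hf i
    have hU : MeasurableSet (⋃ i, f i) := MeasurableSet.iUnion hf
    have hfin : ∀ s : Finset ℕ, ∑ i ∈ s, indicatorConstLp p (hf i) (measure_ne_top μ _) (1 : ℂ) =
        indicatorConstLp p (hs s) (measure_ne_top μ _) 1 := by
      intro s
      induction s using Finset.induction_on with
      | empty => simp
      | insert a s ha ih =>
        rw [Finset.sum_insert ha, ih, ← indicatorConstLp_disjoint_union (hf a) (hs s)]
        · congr 1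
          simp
        · rw [Set.disjoint_iUnion₂_right]
          intro i hi
          exact hd fun h => ha (h ▸ hi)
    simp only [hf, hU, dif_pos]
    have key : HasSum (fun i => indicatorConstLp p (hf i) (measure_ne_top μ _) (1 : ℂ))
        (indicatorConstLp p hU (measure_ne_top μ _) 1) := by
      rw [HasSum]
      simp only [hfin]
      refine tendsto_indicatorConstLp_set hp ?_
      have h1 : ∀ s : Finset ℕ, μ (symmDiff (⋃ i ∈ s, f i) (⋃ i, f i)) =
          μ (⋃ i, f i) - ∑ i ∈ s, μ (f i) := by
        intro s
        have hsub : (⋃ i ∈ s, f i) ⊆ ⋃ i, f i := Set.iUnion₂_subset_iUnion _ _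
        rw [symmDiff_of_le hsub, measure_sdiff hsub (hs s).nullMeasurableSet (measure_ne_top μ _),
          measure_biUnion_finset (fun i _ j _ h => hd h) fun i _ => hf i]
      simp only [h1]
      rw [measure_iUnion hd hf]
      have h2 : HasSum (fun i => μ (f i)) (∑' i, μ (f i)) := ENNReal.summable.hasSum
      have hne : ∑' i, μ (f i) ≠ ⊤ := by
        rw [← measure_iUnion hd hf]
        exact measure_ne_top μ _
      simpa using ENNReal.Tendsto.sub (tendsto_const_nhds (x := ∑' i, μ (f i))) h2 (Or.inl hne)
    exact key.mapL L

/-- Radon–Nikodym: a continuous real functional on `L^p`, `p < ∞`, acts on indicators as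
integration against an integrable density. -/
theorem exists_density (hp : p ≠ ⊤) (L : Lp ℂ p μ →L[ℝ] ℝ) :
    ∃ k : X → ℝ, Measurable k ∧ Integrable k μ ∧ ∀ A (hA : MeasurableSet A),
      L (indicatorConstLp p hA (measure_ne_top μ A) 1) = ∫ x in A, k x ∂μ := by
  set s := functionalMeasure hp L
  have hs : ∀ A (hA : MeasurableSet A),
      s A = L (indicatorConstLp p hA (measure_ne_top μ A) 1) := fun A hA => dif_pos hA
  have hac : s ≪ᵥ μ.toENNRealVectorMeasure := by
    refine VectorMeasure.AbsolutelyContinuous.mk fun A hA h => ?_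
    rw [Measure.toENNRealVectorMeasure_apply_measurable hA] at h
    have h0 : indicatorConstLp p hA (measure_ne_top μ A) (1 : ℂ) = 0 := by
      rw [Lp.eq_zero_iff_ae_eq_zero]
      refine indicatorConstLp_coeFn.trans ?_
      exact indicator_meas_zero h
    rw [hs A hA, h0, map_zero]
  have hwd := SignedMeasure.withDensityᵥ_rnDeriv_eq s μ hac
  refine ⟨s.rnDeriv μ, SignedMeasure.measurable_rnDeriv s μ, SignedMeasure.integrable_rnDeriv s μ,
    fun A hA => ?_⟩
  rw [← hs A hA, ← withDensityᵥ_apply (SignedMeasure.integrable_rnDeriv s μ) hA, hwd]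

theorem exists_complex_density (hp : p ≠ ⊤) (L : StrongDual ℂ (Lp ℂ p μ)) :
    ∃ k : X → ℂ, Measurable k ∧ Integrable k μ ∧ ∀ A (hA : MeasurableSet A),
      L (indicatorConstLp p hA (measure_ne_top μ A) 1) = ∫ x in A, k x ∂μ := by
  obtain ⟨k₁, hm₁, hi₁, h₁⟩ := exists_density hp (Complex.reCLM.comp (L.restrictScalars ℝ))
  obtain ⟨k₂, hm₂, hi₂, h₂⟩ := exists_density hp (Complex.imCLM.comp (L.restrictScalars ℝ))
  refine ⟨fun x => k₁ x + k₂ x * Complex.I, by fun_prop, hi₁.ofReal.add (hi₂.ofReal.mul_const _),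
    fun A hA => ?_⟩
  have hj₁ : IntegrableOn (fun x => (k₁ x : ℂ)) A μ := hi₁.ofReal.integrableOn
  have hj₂ : IntegrableOn (fun x => (k₂ x : ℂ) * Complex.I) A μ :=
    (hi₂.ofReal.mul_const _).integrableOn
  rw [integral_add hj₁ hj₂, integral_mul_const]
  have e₁ : ∫ x in A, ((k₁ x : ℝ) : ℂ) ∂μ = ((∫ x in A, k₁ x ∂μ : ℝ) : ℂ) := integral_ofReal
  have e₂ : ∫ x in A, ((k₂ x : ℝ) : ℂ) ∂μ = ((∫ x in A, k₂ x ∂μ : ℝ) : ℂ) := integral_ofReal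
  rw [e₁, e₂, ← h₁ A hA, ← h₂ A hA]
  exact (Complex.re_add_im _).symm

theorem dual_ext_indicator (hp : p ≠ ⊤) {S T : StrongDual ℂ (Lp ℂ p μ)}
    (h : ∀ A (hA : MeasurableSet A), S (indicatorConstLp p hA (measure_ne_top μ A) 1) =
      T (indicatorConstLp p hA (measure_ne_top μ A) 1)) : S = T := by
  ext φ
  refine Lp.induction hp (fun φ => S φ = T φ) ?_ ?_ ?_ φ
  · intro c A hA hμA
    have e : indicatorConstLp p hA hμA.ne c =
        c • indicatorConstLp p hA (measure_ne_top μ A) (1 : ℂ) := by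
      ext1
      filter_upwards [indicatorConstLp_coeFn (p := p) (hs := hA) (hμs := hμA.ne) (c := c),
        Lp.coeFn_smul c (indicatorConstLp p hA (measure_ne_top μ A) (1 : ℂ)),
        indicatorConstLp_coeFn (p := p) (hs := hA) (hμs := hμA.ne) (c := (1 : ℂ))] with x h1 h2 h3
      rw [h1, h2, Pi.smul_apply, h3]
      by_cases hx : x ∈ A <;> simp [hx]
    rw [Lp.simpleFunc.coe_indicatorConst, e, map_smul, map_smul, h A hA]
  · intro f g hf hg _ h1 h2
    rw [map_add, map_add, h1, h2]
  · exact isClosed_eq S.continuous T.continuous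

variable {q : ENNReal} [Fact (1 ≤ q)] [p.HolderConjugate q]

/-- The pairing `(φ, k) ↦ ∫ φ k dμ` of `L^p` and `L^q`. -/
noncomputable def lqPairing (k : Lp ℂ q μ) : StrongDual ℂ (Lp ℂ p μ) :=
  ((ContinuousLinearMap.mul ℂ ℂ).lpPairing μ p q).flip k

omit [IsFiniteMeasure μ] in
theorem lqPairing_apply (k : Lp ℂ q μ) (φ : Lp ℂ p μ) : lqPairing k φ = ∫ x, φ x * k x ∂μ :=
  (ContinuousLinearMap.mul ℂ ℂ).lpPairing_eq_integral φ k

theorem lqPairing_indicator (k : Lp ℂ q μ) {A : Set X} (hA : MeasurableSet A) :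
    lqPairing (p := p) k (indicatorConstLp p hA (measure_ne_top μ A) 1) = ∫ x in A, k x ∂μ := by
  rw [lqPairing_apply, ← integral_indicator hA]
  refine integral_congr_ae ?_
  filter_upwards [indicatorConstLp_coeFn (p := p) (hs := hA) (hμs := measure_ne_top μ A)
    (c := (1 : ℂ))] with x hx
  rw [hx]
  by_cases h : x ∈ A <;> simp [h]

omit [Fact (1 ≤ q)] in
/-- Duality bound for bounded densities: if `k` is bounded and represents `L` on the functions
that vanish where `k` does, then `‖k‖_q ≤ ‖L‖`. The test function is `\bar k |k|^{q - 2}`. -/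
theorem eLpNorm_le_of_bounded_density (hp1 : 1 < p) (hp : p ≠ ⊤) (L : StrongDual ℂ (Lp ℂ p μ))
    {k : X → ℂ} (hk : Measurable k) {C : ℝ} (hC : ∀ x, ‖k x‖ ≤ C)
    (hL : ∀ φ : Lp ℂ p μ, (∀ᵐ x ∂μ, k x = 0 → φ x = 0) → ∫ x, φ x * k x ∂μ = L φ) :
    eLpNorm k q μ ≤ ENNReal.ofReal ‖L‖ := by
  have hP1 : 1 < p.toReal := by
    rw [← ENNReal.toReal_one]
    exact (ENNReal.toReal_lt_toReal ENNReal.one_ne_top hp).2 hp1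
  have hPQ : p.toReal.HolderConjugate q.toReal := ENNReal.HolderConjugate.toReal hP1
  have hq : q ≠ ⊤ := fun h => hPQ.symm.ne_zero (by rw [h, ENNReal.toReal_top])
  have hp0 : p ≠ 0 := (zero_lt_one.trans hp1).ne'
  have hq0 : q ≠ 0 := fun h => hPQ.symm.ne_zero (by rw [h, ENNReal.toReal_zero])
  set P := p.toReal
  set Q := q.toReal
  have hQ1 : 0 < Q - 1 := hPQ.symm.sub_one_pos
  set t : X → ℂ := fun x => (starRingEnd ℂ) (k x) * ((‖k x‖ ^ (Q - 2) : ℝ) : ℂ) with ht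
  have htn : ∀ x, ‖t x‖ = ‖k x‖ ^ (Q - 1) := by
    intro x
    rcases eq_or_ne (k x) 0 with h | h
    · simp [ht, h, Real.zero_rpow hQ1.ne']
    · have h0 := norm_pos_iff.2 h
      rw [ht, norm_mul, RCLike.norm_conj, Complex.norm_real, Real.norm_of_nonneg (by positivity)]
      nth_rw 1 [← Real.rpow_one ‖k x‖]
      rw [← Real.rpow_add h0]
      ring_nf
  have htk : ∀ x, t x * k x = ((‖k x‖ ^ Q : ℝ) : ℂ) := by
    intro x
    rcases eq_or_ne (k x) 0 with h | h
    · simp [ht, h, Real.zero_rpow hPQ.symm.ne_zero]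
    · have h0 := norm_pos_iff.2 h
      have e : ‖k x‖ ^ Q = ‖k x‖ ^ 2 * ‖k x‖ ^ (Q - 2) := by
        rw [← Real.rpow_natCast, ← Real.rpow_add h0]
        norm_num
      rw [e, Complex.ofReal_mul, ht]
      have : (starRingEnd ℂ) (k x) * k x = ((‖k x‖ ^ 2 : ℝ) : ℂ) := by
        rw [mul_comm, Complex.mul_conj, Complex.normSq_eq_norm_sq]
      rw [← this]
      ring
  have htP : ∀ x, ‖t x‖ ^ P = ‖k x‖ ^ Q := by
    intro x
    rw [htn, ← Real.rpow_mul (norm_nonneg _), hPQ.symm.sub_one_mul_conj]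
  have hkmem : MemLp k q μ := MemLp.of_bound hk.aestronglyMeasurable C (ae_of_all _ hC)
  have htm : Measurable t := by fun_prop
  have htmem : MemLp t p μ := by
    refine MemLp.of_bound htm.aestronglyMeasurable (C ^ (Q - 1)) (ae_of_all _ fun x => ?_)
    rw [htn]
    exact Real.rpow_le_rpow (norm_nonneg _) (hC x) hQ1.le
  set N := ∫ x, ‖k x‖ ^ Q ∂μ
  have hN0 : 0 ≤ N := integral_nonneg fun x => by positivity
  have hNt : ‖htmem.toLp t‖ = N ^ P⁻¹ := by
    rw [Lp.norm_toLp, htmem.eLpNorm_eq_integral_rpow_norm hp0 hp, ENNReal.toReal_ofReal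
      (by positivity)]
    simp only [P, N] at htP ⊢
    simp only [htP]
  have hval : (N : ℂ) = L (htmem.toLp t) := by
    rw [← hL]
    · rw [show (N : ℂ) = ∫ x, ((‖k x‖ ^ Q : ℝ) : ℂ) ∂μ from integral_ofReal.symm]
      refine integral_congr_ae ?_
      filter_upwards [htmem.coeFn_toLp] with x hx
      rw [hx, htk]
    · filter_upwards [htmem.coeFn_toLp] with x hx h
      rw [hx, ht]
      simp [h]
  have hle : N ≤ ‖L‖ * N ^ P⁻¹ := by
    rw [← hNt]
    refine le_trans ?_ (L.le_opNorm _)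
    rw [← hval, Complex.norm_real, Real.norm_of_nonneg hN0]
  rw [hkmem.eLpNorm_eq_integral_rpow_norm hq0 hq]
  refine ENNReal.ofReal_le_ofReal ?_
  change N ^ Q⁻¹ ≤ ‖L‖
  rcases hN0.eq_or_lt with h0 | h0
  · rw [← h0, Real.zero_rpow (inv_ne_zero hPQ.symm.ne_zero)]
    exact norm_nonneg _
  · have hpos : 0 < N ^ P⁻¹ := by positivity
    refine le_of_mul_le_mul_right ?_ hpos
    rw [← Real.rpow_add h0, hPQ.symm.inv_add_inv_eq_one, Real.rpow_one]
    exact hle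

/-- The Riesz representation of functionals on `L^p`, `1 < p < ∞`, over a finite measure. -/
theorem exists_dual_repr (hp1 : 1 < p) (hp : p ≠ ⊤) (L : StrongDual ℂ (Lp ℂ p μ)) :
    ∃ k : Lp ℂ q μ, ‖k‖ ≤ ‖L‖ ∧ ∀ φ : Lp ℂ p μ, L φ = ∫ x, φ x * k x ∂μ := by
  obtain ⟨k, hkm, hki, hk⟩ := exists_complex_density hp L
  set S : ℕ → Set X := fun n => {x | ‖k x‖ ≤ n} with hSdef
  have hS : ∀ n, MeasurableSet (S n) := fun n => measurableSet_le hkm.norm measurable_const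
  set κ : ℕ → X → ℂ := fun n => (S n).indicator k with hκ
  have hκm : ∀ n, Measurable (κ n) := fun n => hkm.indicator (hS n)
  have hκb : ∀ n x, ‖κ n x‖ ≤ n := by
    intro n x
    by_cases h : x ∈ S n
    · rw [hκ]
      simp only [Set.indicator_of_mem h]
      exact h
    · simp [hκ, h]
  have hκmem : ∀ n, MemLp (κ n) q μ := fun n =>
    MemLp.of_bound (hκm n).aestronglyMeasurable n (ae_of_all _ (hκb n))
  -- multiplication by the indicator of `S n`, as an operator on `L^p`
  set T : ℕ → Lp ℂ p μ →L[ℂ] Lp ℂ p μ := fun n => (ContinuousLinearMap.mul ℂ ℂ).holderL μ ⊤ p p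
    (indicatorConstLp ⊤ (hS n) (measure_ne_top μ _) 1) with hT
  have hTcoe : ∀ n (φ : Lp ℂ p μ), T n φ =ᵐ[μ] (S n).indicator φ := by
    intro n φ
    filter_upwards [(ContinuousLinearMap.mul ℂ ℂ).coeFn_holder (r := p)
      (indicatorConstLp ⊤ (hS n) (measure_ne_top μ _) (1 : ℂ)) φ,
      indicatorConstLp_coeFn (p := ⊤) (hs := hS n) (hμs := measure_ne_top μ _)
        (c := (1 : ℂ))] with x h1 h2
    refine h1.trans ?_
    rw [h2]
    by_cases h : x ∈ S n <;> simp [h]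
  have hrep : ∀ n, lqPairing ((hκmem n).toLp (κ n)) = L.comp (T n) := by
    intro n
    refine dual_ext_indicator hp fun A hA => ?_
    rw [lqPairing_indicator]
    have e1 : T n (indicatorConstLp p hA (measure_ne_top μ A) 1) =
        indicatorConstLp p (hA.inter (hS n)) (measure_ne_top μ _) 1 := by
      ext1
      filter_upwards [hTcoe n (indicatorConstLp p hA (measure_ne_top μ A) 1),
        indicatorConstLp_coeFn (p := p) (hs := hA) (hμs := measure_ne_top μ A) (c := (1 : ℂ)),
        indicatorConstLp_coeFn (p := p) (hs := hA.inter (hS n)) (hμs := measure_ne_top μ _)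
          (c := (1 : ℂ))] with x h1 h2 h3
      rw [h1, h3]
      by_cases hx : x ∈ S n <;> by_cases hx' : x ∈ A <;> simp [hx, hx', h2]
    rw [ContinuousLinearMap.comp_apply, e1, hk]
    have e2 : ∫ x in A, (hκmem n).toLp (κ n) x ∂μ = ∫ x in A, κ n x ∂μ :=
      integral_congr_ae (ae_restrict_of_ae (hκmem n).coeFn_toLp)
    rw [e2, hκ, setIntegral_indicator (hS n)]
  have hbound : ∀ n, eLpNorm (κ n) q μ ≤ ENNReal.ofReal ‖L‖ := by
    intro n
    refine eLpNorm_le_of_bounded_density hp1 hp L (hκm n) (hκb n) fun φ hφ => ?_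
    have h1 := congrArg (fun F => F φ) (hrep n)
    simp only [lqPairing_apply, ContinuousLinearMap.comp_apply] at h1
    have h2 : T n φ = φ := by
      ext1
      filter_upwards [hTcoe n φ, hφ] with x hx hx'
      rw [hx]
      by_cases h : x ∈ S n
      · rw [Set.indicator_of_mem h]
      · rw [Set.indicator_of_notMem h, hx' (Set.indicator_of_notMem h k)]
    rw [← h2, ← h1, h2]
    refine integral_congr_ae ?_
    filter_upwards [(hκmem n).coeFn_toLp] with x hx
    rw [hx]
  have hlim : ∀ᵐ x ∂μ, Tendsto (fun n => κ n x) atTop (𝓝 (k x)) := by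
    refine ae_of_all _ fun x => ?_
    obtain ⟨m, hm⟩ := exists_nat_ge ‖k x‖
    refine tendsto_const_nhds.congr' ?_
    filter_upwards [eventually_ge_atTop m] with n hn
    have : x ∈ S n := hm.trans (by exact_mod_cast hn)
    simp [hκ, this]
  have hknorm : eLpNorm k q μ ≤ ENNReal.ofReal ‖L‖ :=
    (Lp.eLpNorm_lim_le_liminf_eLpNorm (fun n => (hκm n).aestronglyMeasurable) _ hlim).trans
      (liminf_le_of_frequently_le' (Frequently.of_forall hbound))
  have hkmem : MemLp k q μ := ⟨hkm.aestronglyMeasurable, hknorm.trans_lt ENNReal.ofReal_lt_top⟩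
  refine ⟨hkmem.toLp k, ?_, fun φ => ?_⟩
  · rw [Lp.norm_toLp]
    exact ENNReal.toReal_le_of_le_ofReal (norm_nonneg _) hknorm
  · rw [← lqPairing_apply]
    refine congrArg (fun F => F φ) (dual_ext_indicator hp (S := L) fun A hA => ?_)
    rw [lqPairing_indicator, hk A hA]
    exact integral_congr_ae (ae_restrict_of_ae hkmem.coeFn_toLp.symm)

end Dual

/-! ### Distance to a subspace -/

/-- Hahn–Banach: the distance to a subspace is attained by a functional that annihilates it. -/
theorem exists_functional_infDist {E : Type*} [NormedAddCommGroup E] [NormedSpace ℂ E]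
    (S : Submodule ℂ E) (x : E) : ∃ L : StrongDual ℂ E, ‖L‖ ≤ 1 ∧ (∀ y ∈ S, L y = 0) ∧
      L x = (Metric.infDist x (S : Set E) : ℂ) := by
  obtain ⟨g, hg1, hg⟩ := exists_dual_vector'' ℂ (Submodule.Quotient.mk x : E ⧸ S)
  have hb : ∀ y, ‖(g.toLinearMap ∘ₗ S.mkQ) y‖ ≤ 1 * ‖y‖ := by
    intro y
    refine (g.le_opNorm _).trans ?_
    exact mul_le_mul hg1 (Submodule.Quotient.norm_mk_le S y) (norm_nonneg _) zero_le_one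
  refine ⟨(g.toLinearMap ∘ₗ S.mkQ).mkContinuous 1 hb,
    LinearMap.mkContinuous_norm_le _ zero_le_one _, fun y hy => ?_, ?_⟩
  · have : (Submodule.Quotient.mk y : E ⧸ S) = 0 := (Submodule.Quotient.mk_eq_zero S).2 hy
    change g (Submodule.Quotient.mk y : E ⧸ S) = 0
    rw [this, map_zero]
  · refine Eq.trans hg ?_
    have : ‖(Submodule.Quotient.mk x : E ⧸ S)‖ = Metric.infDist x (S : Set E) :=
      QuotientAddGroup.norm_mk (S := S.toAddSubgroup) x
    rw [this]
    rfl

/-! ### The weighted measure -/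

section Weighted

variable {α : UnitCirc → ℝ}

theorem isFiniteMeasure_weighted (hα : Integrable α lam) : IsFiniteMeasure (weighted α) :=
  isFiniteMeasure_withDensity_ofReal hα.2

variable {c : ℝ}

theorem ae_weighted (hα : Integrable α lam) (hc : 0 < c) (hcα : ∀ᵐ θ ∂lam, c ≤ α θ) :
    ae (weighted α) = ae lam := by
  refine le_antisymm (withDensity_absolutelyContinuous lam _).ae_le ?_
  refine (withDensity_absolutelyContinuous' hα.aestronglyMeasurable.aemeasurable.ennreal_ofReal
    ?_).ae_le
  filter_upwards [hcα] with θ hθ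
  exact (ENNReal.ofReal_pos.2 (hc.trans_le hθ)).ne'

theorem integrable_weighted_iff (hα : Integrable α lam) (hc : 0 < c)
    (hcα : ∀ᵐ θ ∂lam, c ≤ α θ) {g : UnitCirc → ℂ} :
    Integrable g (weighted α) ↔ Integrable (fun θ => (α θ : ℂ) * g θ) lam := by
  rw [weighted, integrable_withDensity_iff_integrable_smul₀'
    hα.aestronglyMeasurable.aemeasurable.ennreal_ofReal
    (ae_of_all _ fun θ => ENNReal.ofReal_lt_top)]
  refine integrable_congr ?_
  filter_upwards [hcα] with θ hθ
  rw [ENNReal.toReal_ofReal (hc.le.trans hθ), Complex.real_smul]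

theorem integral_weighted (hα : Integrable α lam) (hc : 0 < c)
    (hcα : ∀ᵐ θ ∂lam, c ≤ α θ) (g : UnitCirc → ℂ) :
    ∫ θ, g θ ∂weighted α = ∫ θ, (α θ : ℂ) * g θ ∂lam := by
  rw [weighted, integral_withDensity_eq_integral_toReal_smul₀
    hα.aestronglyMeasurable.aemeasurable.ennreal_ofReal
    (ae_of_all _ fun θ => ENNReal.ofReal_lt_top)]
  refine integral_congr_ae ?_
  filter_upwards [hcα] with θ hθ
  rw [ENNReal.toReal_ofReal (hc.le.trans hθ), Complex.real_smul]

theorem integrable_of_weighted (hα : Integrable α lam) (hc : 0 < c)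
    (hcα : ∀ᵐ θ ∂lam, c ≤ α θ) {g : UnitCirc → ℂ} (hg : Integrable g (weighted α)) :
    Integrable g lam := by
  have h1 := (integrable_weighted_iff hα hc hcα).1 hg
  have hm : AEStronglyMeasurable g lam := hg.aestronglyMeasurable.mono_ac
    (Measure.ae_le_iff_absolutelyContinuous.1 (ae_weighted hα hc hcα).ge)
  refine (h1.norm.const_mul c⁻¹).mono' hm ?_
  filter_upwards [hcα] with θ hθ
  rw [norm_mul, Complex.norm_real, Real.norm_of_nonneg (hc.le.trans hθ), ← mul_assoc]
  refine le_mul_of_one_le_left (norm_nonneg _) ?_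
  rw [inv_mul_eq_div, one_le_div hc]
  exact hθ

/-! ### The weighted Hardy space as a subspace -/

variable {p : ENNReal} [Fact (1 ≤ p)]

theorem integrable_Lp_weighted (hα : Integrable α lam) (hc : 0 < c)
    (hcα : ∀ᵐ θ ∂lam, c ≤ α θ) (F : Lp ℂ p (weighted α)) : Integrable F lam := by
  have := isFiniteMeasure_weighted hα
  exact integrable_of_weighted hα hc hcα ((Lp.memLp F).integrable Fact.out)

/-- An element of `L^p_α` lies in `H^p_α` exactly when its Poisson integral is holomorphic. -/
theorem mem_hardySpace_iff (hα : Integrable α lam) (hc : 0 < c) (hcα : ∀ᵐ θ ∂lam, c ≤ α θ)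
    {F : Lp ℂ p (weighted α)} :
    F ∈ HardySpace α p ↔ DifferentiableOn ℂ (poissonInt F) (Metric.ball 0 1) := by
  have hF := integrable_Lp_weighted hα hc hcα F
  constructor
  · rintro ⟨f, hf, hb⟩
    obtain ⟨hi, hle⟩ := hf.norm_le_exp_poissonInt hb
    refine hf.1.1.congr fun z hz => ?_
    exact (eq_poissonInt_of_majorant hf.1.1 hi hle hb hF (by simpa using hz)).symm
  · intro h
    exact ⟨poissonInt F, isSmirnov_of_poissonInt h hF fun z _ => rfl,
      HasBoundaryValues.of_poissonInt hF fun z _ => rfl⟩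

theorem poissonInt_const_smul {E : Type*} [NormedAddCommGroup E] [NormedSpace ℂ E] (k : ℂ)
    (u : UnitCirc → E) (z : ℂ) :
    poissonInt (fun θ => k • u θ) z = k • poissonInt u z := by
  simp only [poissonInt]
  rw [← integral_smul]
  simp only [smul_comm _ k]

/-- The space `H^p_α` as a subspace of `L^p_α`. -/
def hardySubmodule (p : ENNReal) [Fact (1 ≤ p)] (hα : Integrable α lam) (hc : 0 < c)
    (hcα : ∀ᵐ θ ∂lam, c ≤ α θ) : Submodule ℂ (Lp ℂ p (weighted α)) where
  carrier := HardySpace α p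
  add_mem' {F G} hF hG := by
    rw [mem_hardySpace_iff hα hc hcα] at *
    refine (hF.add hG).congr fun z hz => ?_
    have h : (F + G : Lp ℂ p (weighted α)) =ᵐ[lam] fun θ => F θ + G θ := by
      have := Lp.coeFn_add F G
      rwa [EventuallyEq, ae_weighted hα hc hcα] at this
    rw [poissonInt_congr h, poissonInt_add (integrable_Lp_weighted hα hc hcα F)
      (integrable_Lp_weighted hα hc hcα G) (by simpa using hz)]
    rfl
  zero_mem' := by
    rw [mem_hardySpace_iff hα hc hcα]
    have h : (0 : Lp ℂ p (weighted α)) =ᵐ[lam] fun _ => 0 := by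
      have := Lp.coeFn_zero ℂ p (weighted α)
      rwa [EventuallyEq, ae_weighted hα hc hcα] at this
    refine (differentiableOn_const (0 : ℂ)).congr fun z _ => ?_
    rw [poissonInt_congr h]
    simp [poissonInt]
  smul_mem' k F hF := by
    rw [mem_hardySpace_iff hα hc hcα] at *
    refine (hF.const_smul k).congr fun z _ => ?_
    have h : (k • F : Lp ℂ p (weighted α)) =ᵐ[lam] fun θ => k • F θ := by
      have := Lp.coeFn_smul k F
      rwa [EventuallyEq, ae_weighted hα hc hcα] at this
    rw [poissonInt_congr h, poissonInt_const_smul]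
    rfl

/-- The function `e^{inθ}` belongs to `H^p_α` for `n ≥ 0`. -/
theorem exists_ei_pow_mem_hardySpace (hα : Integrable α lam) (hc : 0 < c)
    (hcα : ∀ᵐ θ ∂lam, c ≤ α θ) (n : ℕ) :
    ∃ F ∈ HardySpace α p, F =ᵐ[lam] fun θ => ei θ ^ n := by
  have := isFiniteMeasure_weighted hα
  have hm : MemLp (fun θ => ei θ ^ n) p (weighted α) :=
    MemLp.of_bound (continuous_ei.pow n).aestronglyMeasurable 1
      (ae_of_all _ fun θ => by simp [norm_ei])
  have h : hm.toLp =ᵐ[lam] fun θ => ei θ ^ n := by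
    have := hm.coeFn_toLp
    rwa [EventuallyEq, ae_weighted hα hc hcα] at this
  refine ⟨hm.toLp, ?_, h⟩
  rw [mem_hardySpace_iff hα hc hcα]
  refine (differentiableOn_pow n).congr fun z hz => ?_
  rw [poissonInt_congr h, poissonInt_ei_pow n (by simpa using hz)]

end Weighted

/-! ### Functions with vanishing Fourier coefficients of negative index -/

/-- If the Fourier coefficients of negative index of an integrable function vanish, its Poisson
integral is half the sum of its Herglotz integral and its mean, hence holomorphic. -/
theorem differentiableOn_poissonInt_of_coeff {G : UnitCirc → ℂ} (hG : Integrable G lam)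
    (h : ∀ n : ℕ, ∫ θ, ei θ ^ (n + 1) * G θ ∂lam = 0) :
    DifferentiableOn ℂ (poissonInt G) (Metric.ball 0 1) := by
  have key : ∀ z : ℂ, ‖z‖ < 1 → poissonInt G z =
      2⁻¹ * ((∫ θ, herglotzRieszKernel 0 z (ei θ) * G θ ∂lam) + ∫ θ, G θ ∂lam) := by
    intro z hz
    set w := (starRingEnd ℂ) z with hw
    have hwn : ‖w‖ < 1 := by rwa [hw, RCLike.norm_conj]
    have hwe : ∀ θ, ‖w * ei θ‖ < 1 := fun θ => by rwa [norm_mul, norm_ei, mul_one]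
    have hi : ∀ n : ℕ, Integrable (fun θ => (w * ei θ) ^ (n + 1) * G θ) lam := fun n =>
      hG.bdd_mul (c := 1)
        ((continuous_const.mul continuous_ei).pow (n + 1)).aestronglyMeasurable
        (ae_of_all _ fun θ => by
          rw [norm_pow]
          exact pow_le_one₀ (norm_nonneg _) (hwe θ).le)
    have h0 : ∀ n : ℕ, ∫ θ, (w * ei θ) ^ (n + 1) * G θ ∂lam = 0 := by
      intro n
      simp only [mul_pow, mul_assoc]
      rw [integral_const_mul, h n, mul_zero]
    have hsum : Summable fun n : ℕ => ∫ θ, ‖(w * ei θ) ^ (n + 1) * G θ‖ ∂lam := by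
      have e : ∀ n : ℕ, ∫ θ, ‖(w * ei θ) ^ (n + 1) * G θ‖ ∂lam =
          ‖w‖ ^ (n + 1) * ∫ θ, ‖G θ‖ ∂lam := by
        intro n
        simp only [norm_mul, norm_pow, norm_ei, mul_one]
        rw [integral_const_mul]
      simp only [e]
      exact ((summable_nat_add_iff 1).2
        (summable_geometric_of_lt_one (norm_nonneg _) hwn)).mul_right _
    have h1 := hasSum_integral_of_summable_integral_norm hi hsum
    simp only [h0] at h1
    have h2 := h1.unique hasSum_zero
    -- the conjugate Herglotz kernel is `1 + 2 Σ_{n ≥ 1} (\bar z e^{iθ})^n`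
    have h3 : ∀ θ, ∑' n : ℕ, (w * ei θ) ^ (n + 1) * G θ =
        2⁻¹ * ((starRingEnd ℂ) (herglotzRieszKernel 0 z (ei θ)) - 1) * G θ := by
      intro θ
      have hne : (1 - w * ei θ) ≠ 0 := by
        intro h4
        have h5 := hwe θ
        rw [← sub_eq_zero.1 h4, norm_one] at h5
        exact lt_irrefl _ h5
      rw [tsum_mul_right]
      congr 1
      simp only [pow_succ']
      rw [tsum_mul_left, tsum_geometric_of_norm_lt_one (hwe θ)]
      have hee : ei θ * (starRingEnd ℂ) (ei θ) = 1 := by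
        rw [Complex.mul_conj, Complex.normSq_eq_norm_sq, norm_ei]; simp
      have hne2 : (starRingEnd ℂ) (ei θ) - w ≠ 0 := by
        rw [hw, ← map_sub]
        exact (map_ne_zero _).2 (ei_sub_ne_zero hz θ)
      have hK : (starRingEnd ℂ) (herglotzRieszKernel 0 z (ei θ)) =
          ((starRingEnd ℂ) (ei θ) + w) / ((starRingEnd ℂ) (ei θ) - w) := by
        simp [herglotzRieszKernel_def, hw]
      rw [hK]
      field_simp
      linear_combination (2 * w) * hee
    simp only [h3] at h2
    have hconj : Integrable (fun θ => (starRingEnd ℂ) (herglotzRieszKernel 0 z (ei θ)) * G θ)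
        lam := hG.bdd_mul (c := 2 / (1 - ‖z‖))
      (Complex.continuous_conj.comp (continuous_herglotz hz)).aestronglyMeasurable
      (ae_of_all _ fun θ => by rw [RCLike.norm_conj]; exact norm_herglotz_le hz θ)
    have h4 : ∫ θ, (starRingEnd ℂ) (herglotzRieszKernel 0 z (ei θ)) * G θ ∂lam =
        ∫ θ, G θ ∂lam := by
      rw [← sub_eq_zero, ← integral_sub hconj hG]
      simp only [mul_assoc] at h2
      rw [integral_const_mul] at h2
      have h5 := (mul_eq_zero.1 h2).resolve_left (by norm_num)
      refine Eq.trans ?_ h5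
      refine integral_congr_ae (ae_of_all _ fun θ => ?_)
      ring
    rw [← h4, ← integral_add (integrable_herglotz_mul hG hz) hconj, ← integral_const_mul,
      poissonInt]
    refine integral_congr_ae (ae_of_all _ fun θ => ?_)
    simp only
    rw [Complex.real_smul, pk_eq_re, Complex.re_eq_add_conj]
    ring
  refine (((differentiableOn_herglotz hG).add_const (∫ θ, G θ ∂lam)).const_mul 2⁻¹).congr
    fun z hz => ?_
  rw [key z (by simpa using hz)]

/-! ### The outer function of modulus `α` -/

section Outer

variable {α : UnitCirc → ℝ} {a : ℂ → ℂ} {c : ℝ}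

/-- Since `α` is bounded below, the reciprocal `b` of the outer function `a` is bounded. This is
where the boundary values of `a` come from. -/
theorem IsOuter.exists_reciprocal (ha : IsOuter α a)
    (hlog : Integrable (fun θ => Real.log (α θ)) lam) (hc : 0 < c)
    (hcα : ∀ᵐ θ ∂lam, c ≤ α θ) : ∃ (b : ℂ → ℂ) (B : UnitCirc → ℂ),
      DifferentiableOn ℂ b (Metric.ball 0 1) ∧
      (∀ z : ℂ, ‖z‖ < 1 → ‖b z‖ = exp (-poissonInt (fun θ => Real.log (α θ)) z)) ∧
      (∀ z : ℂ, ‖z‖ < 1 → a z = (b z)⁻¹) ∧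
      Integrable B lam ∧ HasBoundaryValues b B ∧ ∀ᵐ θ ∂lam, ‖B θ‖ = (α θ)⁻¹ := by
  obtain ⟨γ, hγ, haz⟩ := ha
  have hm : ∀ᵐ θ ∂lam, Real.log c ≤ Real.log (α θ) := by
    filter_upwards [hcα] with θ hθ using Real.log_le_log hc hθ
  obtain ⟨B, hBi, hB, hBn⟩ := exists_hasBoundaryValues_outerNeg hlog hm
  have hγi : ‖γ⁻¹‖ = 1 := by rw [norm_inv, hγ, inv_one]
  refine ⟨fun z => γ⁻¹ * outerNeg (fun θ => Real.log (α θ)) z, fun θ => γ⁻¹ * B θ,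
    (differentiableOn_outerNeg hlog).const_mul _, fun z hz => ?_, fun z hz => ?_,
    hBi.const_mul _, ?_, ?_⟩
  · rw [norm_mul, hγi, one_mul, norm_outerNeg hlog hz]
  · rw [haz z (by simpa using hz), mul_inv, inv_inv, outerNeg, ← Complex.exp_neg, neg_neg]
    rfl
  · filter_upwards [hB] with θ hθ using hθ.const_mul _
  · filter_upwards [hBn, hcα] with θ hθ hθ'
    rw [norm_mul, hγi, one_mul, hθ, exp_neg, exp_log (hc.trans_le hθ')]

section Reciprocal

variable {b : ℂ → ℂ} {B : UnitCirc → ℂ} (hab : ∀ z : ℂ, ‖z‖ < 1 → a z = (b z)⁻¹)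
  (hB : HasBoundaryValues b B) (hBn : ∀ᵐ θ ∂lam, ‖B θ‖ = (α θ)⁻¹) (hc : 0 < c)
  (hcα : ∀ᵐ θ ∂lam, c ≤ α θ)
include hab hB hBn hc hcα

theorem hasBoundaryValues_of_reciprocal : HasBoundaryValues a fun θ => (B θ)⁻¹ := by
  filter_upwards [hB, hBn, hcα] with θ h1 h2 h3
  have hne : B θ ≠ 0 := by
    rw [← norm_pos_iff, h2]
    exact inv_pos.2 (hc.trans_le h3)
  refine (h1.inv₀ hne).congr' ?_
  filter_upwards [Ioo_mem_nhdsLT (zero_lt_one' ℝ)] with r hr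
  exact (hab _ (norm_mul_ei_lt hr.1.le hr.2 θ)).symm

theorem norm_boundaryValue_of_reciprocal : ∀ᵐ θ ∂lam, ‖boundaryValue a θ‖ = α θ := by
  filter_upwards [(hasBoundaryValues_of_reciprocal hab hB hBn hc hcα).ae_eq_boundaryValue, hBn]
    with θ h1 h2
  rw [h1, norm_inv, h2, inv_inv]

theorem boundaryValue_mul_of_reciprocal : ∀ᵐ θ ∂lam, boundaryValue a θ * B θ = 1 := by
  filter_upwards [(hasBoundaryValues_of_reciprocal hab hB hBn hc hcα).ae_eq_boundaryValue, hBn,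
    hcα] with θ h1 h2 h3
  rw [h1, inv_mul_cancel₀]
  rw [← norm_pos_iff, h2]
  exact inv_pos.2 (hc.trans_le h3)

end Reciprocal

end Outer

/-! ### The annihilator of the weighted Hardy space -/

theorem norm_integral_mul_le {X : Type*} [MeasurableSpace X] {μ : Measure X} {p q : ENNReal}
    [p.HolderConjugate q] (φ : Lp ℂ p μ) (k : Lp ℂ q μ) :
    Integrable (fun x => φ x * k x) μ ∧ ‖∫ x, φ x * k x ∂μ‖ ≤ ‖φ‖ * ‖k‖ := by
  set H : Lp ℂ 1 μ := (ContinuousLinearMap.mul ℂ ℂ).holder 1 φ k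
  have h : H =ᵐ[μ] fun x => φ x * k x := (ContinuousLinearMap.mul ℂ ℂ).coeFn_holder φ k
  refine ⟨(L1.integrable_coeFn H).congr h, ?_⟩
  rw [← integral_congr_ae h]
  refine (norm_integral_le_integral_norm _).trans ?_
  rw [← L1.norm_eq_integral_norm]
  refine ((ContinuousLinearMap.mul ℂ ℂ).norm_holder_apply_apply_le φ k).trans ?_
  rw [mul_assoc]
  exact mul_le_of_le_one_left (mul_nonneg ENNReal.toReal_nonneg ENNReal.toReal_nonneg)
    (ContinuousLinearMap.opNorm_mul_le ℂ ℂ)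

section Annihilator

variable {α : UnitCirc → ℝ} {a : ℂ → ℂ} {c : ℝ} {p q : ENNReal}
  (hα : Integrable α lam) (hlog : Integrable (fun θ => Real.log (α θ)) lam) (hc : 0 < c)
  (hcα : ∀ᵐ θ ∂lam, c ≤ α θ)
include hα hc hcα

theorem ae_lam_of_weighted {P : UnitCirc → Prop} (h : ∀ᵐ θ ∂weighted α, P θ) :
    ∀ᵐ θ ∂lam, P θ := by rwa [ae_weighted hα hc hcα] at h

theorem aestronglyMeasurable_lam {g : UnitCirc → ℂ}
    (h : AEStronglyMeasurable g (weighted α)) : AEStronglyMeasurable g lam :=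
  h.mono_ac (Measure.ae_le_iff_absolutelyContinuous.1 (ae_weighted hα hc hcα).ge)

theorem aestronglyMeasurable_weighted {g : UnitCirc → ℂ}
    (h : AEStronglyMeasurable g lam) : AEStronglyMeasurable g (weighted α) :=
  h.mono_ac (Measure.ae_le_iff_absolutelyContinuous.1 (ae_weighted hα hc hcα).le)

/-- If `A e^{iθ} G = α k`, the pairing of `φ` with `A e^{iθ} G` with respect to `λ` is its pairing
with `k` with respect to `α dλ`. -/
theorem integral_twist [p.HolderConjugate q] {A : UnitCirc → ℂ} {G k : Lp ℂ q (weighted α)}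
    (hk : ∀ᵐ θ ∂lam, A θ * ei θ * G θ = α θ * k θ) (φ : Lp ℂ p (weighted α)) :
    Integrable (fun θ => φ θ * A θ * ei θ * G θ) lam ∧
      ∫ θ, φ θ * A θ * ei θ * G θ ∂lam = ∫ θ, φ θ * k θ ∂weighted α := by
  have e : (fun θ => (α θ : ℂ) * (φ θ * k θ)) =ᵐ[lam] fun θ => φ θ * A θ * ei θ * G θ := by
    filter_upwards [hk] with θ hθ
    linear_combination (-φ θ) * hθ
  rw [integral_weighted hα hc hcα, ← integral_congr_ae e]
  exact ⟨((integrable_weighted_iff hα hc hcα).1 (norm_integral_mul_le φ k).1).congr e, rfl⟩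

/-- Multiplication by the unimodular function `A e^{iθ} / α` maps `L^q_α` isometrically to
itself. -/
theorem exists_twist {A : UnitCirc → ℂ} (hA : AEStronglyMeasurable A lam)
    (hAn : ∀ᵐ θ ∂lam, ‖A θ‖ = α θ) (G : Lp ℂ q (weighted α)) :
    ∃ k : Lp ℂ q (weighted α), ‖k‖ = ‖G‖ ∧ ∀ᵐ θ ∂lam, A θ * ei θ * G θ = α θ * k θ := by
  set κ : UnitCirc → ℂ := fun θ => (α θ : ℂ)⁻¹ * (A θ * ei θ * G θ) with hκ
  have hn : ∀ᵐ θ ∂lam, ‖κ θ‖ = ‖G θ‖ := by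
    filter_upwards [hAn, hcα] with θ h1 h2
    have h3 : 0 < α θ := hc.trans_le h2
    simp only [hκ, norm_mul, norm_inv, h1, norm_ei, Complex.norm_real, Real.norm_of_nonneg h3.le]
    field_simp
  have hn' : ∀ᵐ θ ∂weighted α, ‖κ θ‖ = ‖G θ‖ := by rwa [ae_weighted hα hc hcα]
  have hm : AEStronglyMeasurable κ (weighted α) := by
    refine aestronglyMeasurable_weighted hα hc hcα ?_
    have h1 : AEStronglyMeasurable (fun θ => (α θ : ℂ)⁻¹) lam :=
      hα.ofReal.aestronglyMeasurable.aemeasurable.inv.aestronglyMeasurable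
    exact h1.mul ((hA.mul continuous_ei.aestronglyMeasurable).mul
      (aestronglyMeasurable_lam hα hc hcα (Lp.aestronglyMeasurable G)))
  have hmem : MemLp κ q (weighted α) := (Lp.memLp G).congr_norm hm (hn'.mono fun _ h => h.symm)
  refine ⟨hmem.toLp, ?_, ?_⟩
  · rw [Lp.norm_toLp, Lp.norm_def, eLpNorm_congr_norm_ae hn']
  · filter_upwards [ae_lam_of_weighted hα hc hcα hmem.coeFn_toLp, hcα] with θ h1 h2
    have h3 : (α θ : ℂ) ≠ 0 := by exact_mod_cast (hc.trans_le h2).ne'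
    rw [h1, hκ]
    field_simp

variable {b : ℂ → ℂ} {B : UnitCirc → ℂ}
  (hb : DifferentiableOn ℂ b (Metric.ball 0 1))
  (hbn : ∀ z : ℂ, ‖z‖ < 1 → ‖b z‖ = exp (-poissonInt (fun θ => Real.log (α θ)) z))
  (hab : ∀ z : ℂ, ‖z‖ < 1 → a z = (b z)⁻¹) (hBi : Integrable B lam)
  (hB : HasBoundaryValues b B) (hBn : ∀ᵐ θ ∂lam, ‖B θ‖ = (α θ)⁻¹)
include hlog hb hbn hab hB hBn

omit hα in
/-- For `f ∈ H^p_α` and `g ∈ H^q_α`, the function `z f a g` vanishes at the origin, has integrable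
boundary values, and has a harmonic majorant; so its boundary function has mean zero. -/
theorem integral_hardy_mul_hardy {F : Lp ℂ p (weighted α)} {G : Lp ℂ q (weighted α)}
    (hF : F ∈ HardySpace α p) (hG : G ∈ HardySpace α q)
    (hi : Integrable (fun θ => F θ * boundaryValue a θ * ei θ * G θ) lam) :
    ∫ θ, F θ * boundaryValue a θ * ei θ * G θ ∂lam = 0 := by
  obtain ⟨f, hfs, hf⟩ := hF
  obtain ⟨g, hgs, hg⟩ := hG
  obtain ⟨hFi, hfle⟩ := hfs.norm_le_exp_poissonInt hf
  obtain ⟨hGi, hgle⟩ := hgs.norm_le_exp_poissonInt hg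
  have hAb := hasBoundaryValues_of_reciprocal hab hB hBn hc hcα
  have hA : HasBoundaryValues a (boundaryValue a) := hAb.congr hAb.ae_eq_boundaryValue.symm
  have hbne : ∀ z : ℂ, ‖z‖ < 1 → b z ≠ 0 := fun z hz => by
    rw [← norm_pos_iff, hbn z hz]
    exact exp_pos _
  have had : DifferentiableOn ℂ a (Metric.ball 0 1) :=
    (hb.inv fun z hz => hbne z (by simpa using hz)).congr fun z hz => hab z (by simpa using hz)
  have hid : HasBoundaryValues (fun z => z) ei := by
    refine ae_of_all _ fun θ => ?_
    have : ContinuousAt (fun r : ℝ => (r : ℂ) * ei θ) 1 := by fun_prop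
    simpa using this.tendsto.mono_left (nhdsWithin_le_nhds (s := Set.Iio 1))
  have hd : DifferentiableOn ℂ (fun z => f z * a z * z * g z) (Metric.ball 0 1) :=
    ((hfs.1.1.mul had).mul differentiableOn_id).mul hgs.1.1
  have := eq_poissonInt_of_majorant hd ((hFi.add hlog).add hGi) (fun z hz => ?_)
    (((hf.mul hA).mul hid).mul hg) hi (z := 0) (by simp)
  · rw [poissonInt_zero] at this
    rw [← this]
    simp
  · have h1 := poissonInt_add (u := fun θ => posLog ‖F θ‖ + Real.log (α θ)) (hFi.add hlog) hGi hz
    have h2 := poissonInt_add hFi hlog hz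
    change _ ≤ exp (poissonInt (fun θ => (posLog ‖F θ‖ + Real.log (α θ)) + posLog ‖G θ‖) z)
    rw [h1, h2, exp_add, exp_add, norm_mul, norm_mul, norm_mul, hab z hz, norm_inv, hbn z hz,
      ← exp_neg, neg_neg]
    refine mul_le_mul ?_ (hgle z hz) (norm_nonneg _) (by positivity)
    refine (mul_le_of_le_one_right (by positivity) hz.le).trans ?_
    exact mul_le_mul_of_nonneg_right (hfle z hz) (exp_pos _).le

include hBi in
/-- Every functional on `L^p_α` that annihilates `H^p_α` comes from some `G ∈ H^q_α`. If `k` is its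
density, the coefficients of negative index of `α k e^{-iθ}` vanish, so this is the boundary
function of a Smirnov function, which is then divided by the outer function. -/
theorem exists_hardy_of_annihilates [Fact (1 ≤ p)] [Fact (1 ≤ q)] {k : Lp ℂ q (weighted α)}
    (hk : ∀ F ∈ HardySpace α p, ∫ θ, F θ * k θ ∂weighted α = 0) :
    ∃ G ∈ HardySpace α q, ‖G‖ = ‖k‖ ∧
      ∀ᵐ θ ∂lam, boundaryValue a θ * ei θ * G θ = α θ * k θ := by
  have := isFiniteMeasure_weighted hα
  have hee : ∀ θ, ei θ * (starRingEnd ℂ) (ei θ) = 1 := fun θ => by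
    rw [Complex.mul_conj, Complex.normSq_eq_norm_sq, norm_ei]; simp
  set G₀ : UnitCirc → ℂ := fun θ => (starRingEnd ℂ) (ei θ) * (α θ * k θ) with hG₀
  have hG₀i : Integrable G₀ lam :=
    ((integrable_weighted_iff hα hc hcα).1 ((Lp.memLp k).integrable Fact.out)).bdd_mul (c := 1)
      (Complex.continuous_conj.comp continuous_ei).aestronglyMeasurable
      (ae_of_all _ fun θ => by rw [RCLike.norm_conj, norm_ei])
  have hcoef : ∀ n : ℕ, ∫ θ, ei θ ^ (n + 1) * G₀ θ ∂lam = 0 := by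
    intro n
    obtain ⟨F, hF, hFe⟩ := exists_ei_pow_mem_hardySpace (p := p) hα hc hcα n
    rw [← hk F hF, integral_weighted hα hc hcα]
    refine integral_congr_ae ?_
    filter_upwards [hFe] with θ hθ
    rw [hθ, hG₀]
    linear_combination ei θ ^ n * (α θ * k θ) * hee θ
  have hd := differentiableOn_poissonInt_of_coeff hG₀i hcoef
  have hG₀b : HasBoundaryValues (poissonInt G₀) G₀ := .of_poissonInt hG₀i fun z _ => rfl
  obtain ⟨hG₀l, hle⟩ :=
    (isSmirnov_of_poissonInt hd hG₀i fun z _ => rfl).norm_le_exp_poissonInt hG₀b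
  set γ : UnitCirc → ℂ := fun θ => G₀ θ * B θ with hγ
  have hn : ∀ᵐ θ ∂lam, ‖γ θ‖ = ‖k θ‖ := by
    filter_upwards [hBn, hcα] with θ h1 h2
    have h3 : 0 < α θ := hc.trans_le h2
    simp only [hγ, hG₀, norm_mul, h1, RCLike.norm_conj, norm_ei, Complex.norm_real,
      Real.norm_of_nonneg h3.le]
    field_simp
  have hn' : ∀ᵐ θ ∂weighted α, ‖γ θ‖ = ‖k θ‖ := by rwa [ae_weighted hα hc hcα]
  have hmem : MemLp γ q (weighted α) := (Lp.memLp k).congr_norm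
    (aestronglyMeasurable_weighted hα hc hcα
      (hG₀i.aestronglyMeasurable.mul hBi.aestronglyMeasurable)) (hn'.mono fun _ h => h.symm)
  have hγi : Integrable γ lam := integrable_of_weighted hα hc hcα (hmem.integrable Fact.out)
  have hγb : HasBoundaryValues (fun z => poissonInt G₀ z * b z) γ := hG₀b.mul hB
  have hγe := ae_lam_of_weighted hα hc hcα hmem.coeFn_toLp
  refine ⟨hmem.toLp, ⟨fun z => poissonInt G₀ z * b z, ?_, hγb.congr (EventuallyEq.symm hγe)⟩,
    ?_, ?_⟩
  · refine isSmirnov_of_poissonInt (hd.mul hb) hγi fun z hz => ?_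
    refine eq_poissonInt_of_majorant (hd.mul hb) (hG₀l.sub hlog) (fun w hw => ?_) hγb hγi hz
    change _ ≤ exp (poissonInt (fun θ => posLog ‖G₀ θ‖ - Real.log (α θ)) w)
    rw [poissonInt_sub hG₀l hlog hw, sub_eq_add_neg, exp_add, ← hbn w hw]
    exact (norm_mul_le _ _).trans (mul_le_mul_of_nonneg_right (hle w hw) (norm_nonneg _))
  · rw [Lp.norm_toLp, Lp.norm_def, eLpNorm_congr_norm_ae hn']
  · filter_upwards [hγe, boundaryValue_mul_of_reciprocal hab hB hBn hc hcα] with θ h1 h2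
    rw [h1, hγ, hG₀]
    linear_combination (α θ * k θ) * (ei θ * (starRingEnd ℂ) (ei θ)) * h2 + (α θ * k θ) * hee θ

end Annihilator

/-! ### The duality formula -/

theorem theorem2p1
    (α : UnitCirc → ℝ) (hα : Integrable α lam)
    (hlog : Integrable (fun θ => Real.log (α θ)) lam)
    (c : ℝ) (hc : 0 < c) (hcα : ∀ᵐ θ ∂lam, c ≤ α θ)
    (a : ℂ → ℂ) (ha : IsOuter α a)
    (p q : ENNReal) [Fact (1 ≤ p)] (hp : 1 < p) (hp' : p ≠ ⊤) (hpq : p.HolderConjugate q)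
    (φ : Lp ℂ p (weighted α)) :
    HasBoundaryValues a (boundaryValue a) ∧
    (∀ᵐ θ ∂lam, ‖boundaryValue a θ‖ = α θ) ∧
    (∀ g ∈ HardySpace α q,
      Integrable (fun θ => φ θ * boundaryValue a θ * ei θ * g θ) lam) ∧
    IsLUB
      {x : ℝ | ∃ g ∈ HardySpace α q, ‖g‖ = 1 ∧
        x = ‖∫ θ, φ θ * boundaryValue a θ * ei θ * g θ ∂lam‖}
      (Metric.infDist φ (HardySpace α p)) := by
  have := hpq
  have : Fact (1 ≤ q) := ⟨ENNReal.HolderConjugate.one_le q p⟩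
  have := isFiniteMeasure_weighted hα
  obtain ⟨b, B, hb, hbn, hab, hBi, hB, hBn⟩ := ha.exists_reciprocal hlog hc hcα
  have hAb := hasBoundaryValues_of_reciprocal hab hB hBn hc hcα
  have hAn := norm_boundaryValue_of_reciprocal hab hB hBn hc hcα
  have hAm : AEStronglyMeasurable (boundaryValue a) lam :=
    (hBi.aestronglyMeasurable.aemeasurable.inv.aestronglyMeasurable).congr
      hAb.ae_eq_boundaryValue.symm
  have hint : ∀ (ψ : Lp ℂ p (weighted α)) (g : Lp ℂ q (weighted α)),
      Integrable (fun θ => ψ θ * boundaryValue a θ * ei θ * g θ) lam := by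
    intro ψ g
    obtain ⟨k, -, hk⟩ := exists_twist hα hc hcα hAm hAn g
    exact (integral_twist hα hc hcα hk ψ).1
  set S := hardySubmodule p hα hc hcα
  refine ⟨hAb.congr hAb.ae_eq_boundaryValue.symm, hAn, fun g _ => hint φ g, ?_, ?_⟩
  · rintro x ⟨g, hg, hg1, rfl⟩
    obtain ⟨k, hkn, hk⟩ := exists_twist hα hc hcα hAm hAn g
    refine (Metric.le_infDist ⟨0, S.zero_mem⟩).2 fun f hf => ?_
    -- the functional attached to `g` annihilates `f` and has norm at most `1`
    have h0 := integral_hardy_mul_hardy hlog hc hcα hb hbn hab hB hBn hf hg (hint f g)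
    rw [(integral_twist hα hc hcα hk f).2, ← lqPairing_apply] at h0
    have h1 : ∫ θ, φ θ * boundaryValue a θ * ei θ * g θ ∂lam = lqPairing k (φ - f) := by
      rw [(integral_twist hα hc hcα hk φ).2, ← lqPairing_apply, map_sub, h0, sub_zero]
    rw [h1, lqPairing_apply, dist_eq_norm]
    refine (norm_integral_mul_le (φ - f) k).2.trans_eq ?_
    rw [hkn, hg1, mul_one]
  · intro x hx
    have hlow : ∀ G ∈ HardySpace α q, G ≠ 0 →
        ‖∫ θ, φ θ * boundaryValue a θ * ei θ * G θ ∂lam‖ ≤ x * ‖G‖ := by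
      intro G hG hG0
      have hn : 0 < ‖G‖ := norm_pos_iff.2 hG0
      set k : ℂ := ((‖G‖⁻¹ : ℝ) : ℂ)
      have hk : ‖k‖ = ‖G‖⁻¹ := by rw [Complex.norm_real, norm_inv, norm_norm]
      have h1 := hx ⟨k • G, (hardySubmodule q hα hc hcα).smul_mem k hG,
        by rw [norm_smul, hk, inv_mul_cancel₀ hn.ne'], rfl⟩
      have h2 : ∫ θ, φ θ * boundaryValue a θ * ei θ * (k • G) θ ∂lam =
          k * ∫ θ, φ θ * boundaryValue a θ * ei θ * G θ ∂lam := by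
        rw [← integral_const_mul]
        refine integral_congr_ae ?_
        filter_upwards [ae_lam_of_weighted hα hc hcα (Lp.coeFn_smul k G)] with θ hθ
        rw [hθ, Pi.smul_apply, smul_eq_mul]
        ring
      rw [h2, norm_mul, hk, inv_mul_le_iff₀ hn] at h1
      exact h1.trans_eq (mul_comm _ _)
    rcases (Metric.infDist_nonneg (x := φ) (s := HardySpace α p)).eq_or_lt with hd | hd
    · rw [← hd]
      -- here it only matters that the set is nonempty, which the constant functions show
      obtain ⟨G, hG, hGe⟩ := exists_ei_pow_mem_hardySpace (p := q) hα hc hcα 0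
      have hG0 : G ≠ 0 := by
        rintro rfl
        have h := ae_lam_of_weighted hα hc hcα (Lp.coeFn_zero ℂ q (weighted α))
        obtain ⟨θ, h1, h2⟩ := (hGe.and h).exists
        rw [h1] at h2
        simp at h2
      exact nonneg_of_mul_nonneg_left ((norm_nonneg _).trans (hlow G hG hG0)) (norm_pos_iff.2 hG0)
    obtain ⟨L, hL1, hLS, hLφ⟩ := exists_functional_infDist S φ
    obtain ⟨k, hkL, hLk⟩ := exists_dual_repr (q := q) hp hp' L
    obtain ⟨G, hG, hGk, hGe⟩ := exists_hardy_of_annihilates (p := p) hα hlog hc hcα hb hbn hab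
      hBi hB hBn (k := k) fun F hF => (hLk F).symm.trans (hLS F hF)
    have hval : ‖∫ θ, φ θ * boundaryValue a θ * ei θ * G θ ∂lam‖ =
        Metric.infDist φ (HardySpace α p) := by
      rw [(integral_twist hα hc hcα hGe φ).2, ← hLk φ, hLφ, Complex.norm_real,
        Real.norm_of_nonneg Metric.infDist_nonneg]
      rfl
    have hG0 : G ≠ 0 := by
      rintro rfl
      rw [norm_zero, eq_comm, norm_eq_zero] at hGk
      have h := (norm_integral_mul_le φ k).2
      rw [← (integral_twist hα hc hcα hGe φ).2, hval, hGk, norm_zero, mul_zero] at h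
      exact hd.not_ge h
    have h1 := hlow G hG hG0
    rw [hval] at h1
    have hx0 : 0 < x := pos_of_mul_pos_left (hd.trans_le h1) (norm_nonneg _)
    exact h1.trans (mul_le_of_le_one_right hx0.le (hGk.trans_le (hkL.trans hL1)))
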